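/- Let $L,d\ge 2$ be integers, $p\in(0,1)$, and let $q\ge 1$ be an integer. Let $T_{L,d}=(V,E)$ be the discrete torus with vertex set $V=(\mathbb{Z}/L\mathbb{Z})^d$, regarded as a simple graph in which two distinct vertices are adjacent iff they differ by $\pm1$ in exactly one coordinate and agree in all the others. For $A\subseteq E$ let $c(A)$ be the number of connected components of $(V,A)$ (isolated vertices included), and let $$\mu(A)=\frac1Z\Bigl(\frac p{1-p}\Bigr)^{|A|}q^{c(A)},\qquad A\subseteq E,$$ with $Z$ the normalizing constant, be the random-cluster measure. The (lazy) single-bond dynamics is the Markov chain on $\{A: A\subseteq E\}$ with transition matrix $$P_{\rm SB}(A,B)=\frac{\mathbf 1(A=B)}2+\frac1{2|E|}\sum_{e\in E}P_e(A,B),$$ where $P_e(A,\cdot)$ chooses $A\cup\{e\}$ with probability $r$ and $A\setminus\{e\}$ with probability $1-r$, with $r=p$ if the endpoints of $e$ are connected in $(V,A)$, and $r=p/q$ otherwise. This chain is ergodic (irreducible and aperiodic), $\mu$ is its unique stationary distribution, and its mixing time $$\tau(P_{\rm SB})=\min\Bigl\{t\in\{0,1,2,\dots\}:\ \max_{A\subseteq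 E}\sum_{B\subseteq E}\bigl|P_{\rm SB}^t(A,B)-\mu(B)\bigr|\le\frac1e\Bigr\}$$ satisfies $$\tau(P_{\rm SB})\le\exp\bigl\{k_1(p)+k_2(q)\,L^{d-1}\bigr\},$$ where $$k_1(p)=\log\Bigl(1+\log\frac1{p(1-p)}\Bigr),\qquad k_2(q)=4+3\log q+\log(1+\log q).$$ -/

import Mathlib

open scoped Matrix

/-- The discrete `d`-dimensional torus `(ℤ/Lℤ)^d`: two distinct vertices are neighbours iff they
differ by `±1` in exactly one coordinate. -/
def torusGraph (L d : ℕ) : SimpleGraph (Fin d → ZMod L) :=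
  SimpleGraph.fromRel fun x y => ∃ i, y = x + Pi.single i 1

instance (L d : ℕ) : DecidableRel (torusGraph L d).Adj :=
  inferInstanceAs (DecidableRel (SimpleGraph.fromRel fun x y : Fin d → ZMod L =>
    ∃ i, y = x + Pi.single i 1).Adj)

namespace RandomCluster

section Model

variable {V : Type*} (G : SimpleGraph V)

/-- The state space of the random-cluster model on `G = (V, E)`: the subsets `A` of `E`. -/
abbrev State : Type _ := Finset G.edgeSet

/-- The graph `(V, A)`. -/
def subgraph (A : State G) : SimpleGraph V :=
  SimpleGraph.fromEdgeSet (Subtype.val '' (A : Set G.edgeSet))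

/-- `c(A)`: the number of connected components of `(V, A)`, isolated vertices included. -/
noncomputable def numComponents (A : State G) : ℕ :=
  Nat.card (subgraph G A).ConnectedComponent

/-- The endpoints of the edge `e` are connected in `(V, A)`. -/
def EndsConnected (A : State G) (e : G.edgeSet) : Prop :=
  ∀ u ∈ (e : Sym2 V), ∀ v ∈ (e : Sym2 V), (subgraph G A).Reachable u v

/-- The unnormalized random-cluster weight `(p / (1 - p)) ^ |A| * q ^ c(A)`. -/
noncomputable def weight (p : ℝ) (q : ℕ) (A : State G) : ℝ :=
  (p / (1 - p)) ^ A.card * (q : ℝ) ^ numComponents G A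

variable [Fintype V] [DecidableEq V] [DecidableRel G.Adj]

/-- The normalization constant `Z(G, p, q)`. -/
noncomputable def partitionFunction (p : ℝ) (q : ℕ) : ℝ :=
  ∑ A : State G, weight G p q A

/-- The random-cluster measure `μ`, as a probability vector. -/
noncomputable def rcMeasure (p : ℝ) (q : ℕ) (A : State G) : ℝ :=
  weight G p q A / partitionFunction G p q

open Classical in
/-- The transition matrix `P_e` of the update of the single edge `e`: if the endpoints of `e` are
connected in `(V, A)`, the new state is `A ∪ e` with probability `p` and `A \ e` with probability
`1 - p`; otherwise `p` is replaced by `p / q`. -/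
noncomputable def edgeUpdate (p : ℝ) (q : ℕ) (e : G.edgeSet) :
    Matrix (State G) (State G) ℝ :=
  Matrix.of fun A B =>
    if symmDiff A B ⊆ {e} then
      if EndsConnected G A e then
        if e ∈ B then p else 1 - p
      else
        if e ∈ B then p / q else 1 - p / q
    else 0

/-- The transition matrix of the (lazy) single-bond dynamics:
`P_SB = I / 2 + (1 / (2 |E|)) ∑ e, P_e`. -/
noncomputable def singleBond (p : ℝ) (q : ℕ) : Matrix (State G) (State G) ℝ :=
  Matrix.of fun A B =>
    (if A = B then 1 else 0) / 2
      + 1 / (2 * (Fintype.card G.edgeSet : ℝ)) * ∑ e : G.edgeSet, edgeUpdate G p q e A B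

end Model

end RandomCluster

section MarkovChain

variable {Ω : Type*} [Fintype Ω]

/-- `π` is a probability vector with `π P = π`. -/
def IsStationaryDistribution (P : Matrix Ω Ω ℝ) (π : Ω → ℝ) : Prop :=
  π ∈ stdSimplex ℝ Ω ∧ π ᵥ* P = π

variable [DecidableEq Ω]

/-- `P` is the transition matrix of an ergodic (irreducible and aperiodic) Markov chain, and `π`
is its unique stationary distribution. -/
structure IsErgodicChain (P : Matrix Ω Ω ℝ) (π : Ω → ℝ) : Prop where
  nonneg : ∀ x y, 0 ≤ P x y
  row_sum : ∀ x, ∑ y, P x y = 1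
  irreducible : ∀ x y, ∃ t : ℕ, 0 < (P ^ t) x y
  aperiodic : ∀ x, ∀ g : ℕ, (∀ t : ℕ, 0 < (P ^ t) x x → g ∣ t) → g = 1
  stationary : IsStationaryDistribution P π
  unique : ∀ ν, IsStationaryDistribution P ν → ν = π

/-- `τ` is the mixing time of the chain `P` with stationary distribution `π`:
`τ = min {t | max_x ∑ y, |P ^ t (x, y) - π y| ≤ 1 / e}`. -/
def IsMixingTime (P : Matrix Ω Ω ℝ) (π : Ω → ℝ) (τ : ℕ) : Prop :=
  IsLeast {t : ℕ | ∀ x, ∑ y, |(P ^ t) x y - π y| ≤ 1 / Real.exp 1} τ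

end MarkovChain

/-- `k₁(p) = log (1 + log (1 / (p (1 - p))))`. -/
noncomputable def k₁ (p : ℝ) : ℝ := Real.log (1 + Real.log (1 / (p * (1 - p))))

/-- `k₂(q) = 4 + 3 log q + log (1 + log q)`. -/
noncomputable def k₂ (q : ℕ) : ℝ := 4 + 3 * Real.log q + Real.log (1 + Real.log q)

/-! The proof bounds the spectral gap by canonical paths and then passes from gap to mixing time in
`L²`.

Fix an order of the edges. The path from `A` to `B` replaces the status of each edge in `A` by that
in `B`, one edge at a time, so at each stage the current state is `B` on an initial segment `S` and
`A` off it. Pair this state with the complementary one (`A` on `S`, `B` off it): exchanging the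
parts inside `S` is an involution on pairs that preserves the total number of edges. It changes the
total number of components by less than the number of vertices meeting both `S` and its complement
(`numComponents_exchange`), so products of weights change by at most a power of `q`. Sorting the
edges of the torus by first coordinate keeps this interface within three layers, hence within `3 * L
^ (d - 1)` vertices.

The bound on a single path step (`sum_sum_weight_mul_sub_sq_le`) evaluates weights with the moving
edge present. Then the update rates cancel exactly and the gap bound
`weightedVariance_le_dirichletForm`, with constant `2 |E|² q ^ w`, does not involve `p`. The
parameter enters only through the smallest value of `μ`, and only logarithmically.

Component counts are handled linearly: `c(A)` is the dimension of the space of functions constant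
along the edges of `A`. Unions of edge sets become intersections of subspaces, and the exchange
inequality follows from the dimension formula. -/

section LazyChain

/-! ### Lazy chains: from a Poincaré inequality to mixing and uniqueness. -/

variable {Ω : Type*} [Fintype Ω]

/-- The variance of `f` under the weights `π`. -/
def weightedVariance (π f : Ω → ℝ) : ℝ := ∑ x, π x * f x ^ 2 - (∑ x, π x * f x) ^ 2

/-- The Dirichlet form of the chain `P` with stationary weights `π`. -/
noncomputable def dirichletForm (P : Matrix Ω Ω ℝ) (π f : Ω → ℝ) : ℝ :=
  1 / 2 * ∑ x, ∑ y, π x * P x y * (f y - f x) ^ 2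

theorem sum_sum_mul_sub_sq (π f : Ω → ℝ) (hsum : ∑ x, π x = 1) :
    ∑ x, ∑ y, π x * π y * (f y - f x) ^ 2 = 2 * weightedVariance π f := by
  have h : ∀ x y, π x * π y * (f y - f x) ^ 2
      = π x * (π y * f y ^ 2) + (π x * f x ^ 2) * π y - 2 * ((π x * f x) * (π y * f y)) := by
    intro x y; ring
  simp_rw [h, Finset.sum_sub_distrib, Finset.sum_add_distrib, ← Finset.mul_sum, ← Finset.sum_mul,
    hsum]
  unfold weightedVariance
  ring

/-- Jensen's inequality with a quantitative gain. The increments `f y - f x` vanish on the diagonal,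
and laziness leaves off-diagonal mass at most `1 / 2`, so Cauchy–Schwarz bounds the square of the
mean increment by half the mean square. This replaces any discussion of negative eigenvalues. -/
theorem mulVec_sq_le_of_lazy (P : Matrix Ω Ω ℝ) (hP : ∀ x y, 0 ≤ P x y)
    (hrow : ∀ x, ∑ y, P x y = 1) (hlazy : ∀ x, 1 / 2 ≤ P x x) (f : Ω → ℝ) (x : Ω) :
    (P *ᵥ f) x ^ 2 + 1 / 2 * ∑ y, P x y * (f y - f x) ^ 2 ≤ ∑ y, P x y * f y ^ 2 := by
  classical
  have h1 : (P *ᵥ f) x = f x + ∑ y, P x y * (f y - f x) := by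
    simp only [Matrix.mulVec, dotProduct, mul_sub, Finset.sum_sub_distrib, ← Finset.sum_mul, hrow]
    ring
  have h2 : ∑ y, P x y * f y ^ 2 = f x ^ 2 + 2 * f x * ∑ y, P x y * (f y - f x)
      + ∑ y, P x y * (f y - f x) ^ 2 := by
    have : ∀ y, P x y * f y ^ 2 = P x y * f x ^ 2 + 2 * f x * (P x y * (f y - f x))
        + P x y * (f y - f x) ^ 2 := fun y => by ring
    simp_rw [this, Finset.sum_add_distrib, ← Finset.sum_mul, ← Finset.mul_sum, hrow, one_mul]
  have h3 : (∑ y, P x y * (f y - f x)) ^ 2 ≤ 1 / 2 * ∑ y, P x y * (f y - f x) ^ 2 := by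
    have e1 : ∑ y, P x y * (f y - f x) = ∑ y ∈ Finset.univ.erase x, P x y * (f y - f x) := by
      rw [← Finset.add_sum_erase _ _ (Finset.mem_univ x)]; simp
    have e2 : ∑ y, P x y * (f y - f x) ^ 2
        = ∑ y ∈ Finset.univ.erase x, P x y * (f y - f x) ^ 2 := by
      rw [← Finset.add_sum_erase _ _ (Finset.mem_univ x)]; simp
    have e3 : ∑ y ∈ Finset.univ.erase x, P x y ≤ 1 / 2 := by
      have := Finset.add_sum_erase Finset.univ (P x) (Finset.mem_univ x)
      have := hrow x
      have := hlazy x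
      linarith
    rw [e1, e2]
    refine (Finset.sum_sq_le_sum_mul_sum_of_sq_le_mul _ (fun y _ => hP x y)
      (fun y _ => mul_nonneg (hP x y) (sq_nonneg (f y - f x))) (fun y _ => le_of_eq (by ring))).trans ?_
    exact mul_le_mul_of_nonneg_right e3
      (Finset.sum_nonneg fun y _ => mul_nonneg (hP x y) (sq_nonneg _))
  rw [h1, h2]
  nlinarith

theorem sum_mul_mulVec_of_stationary (P : Matrix Ω Ω ℝ) (π : Ω → ℝ) (hπP : π ᵥ* P = π)
    (f : Ω → ℝ) : ∑ x, π x * (P *ᵥ f) x = ∑ x, π x * f x := by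
  have := Matrix.dotProduct_mulVec π P f
  rw [hπP] at this
  exact this

theorem weightedVariance_mulVec_add_dirichletForm_le (P : Matrix Ω Ω ℝ) (π : Ω → ℝ)
    (hπ : ∀ x, 0 ≤ π x) (hπP : π ᵥ* P = π) (hP : ∀ x y, 0 ≤ P x y)
    (hrow : ∀ x, ∑ y, P x y = 1) (hlazy : ∀ x, 1 / 2 ≤ P x x) (f : Ω → ℝ) :
    weightedVariance π (P *ᵥ f) + dirichletForm P π f ≤ weightedVariance π f := by
  have h1 : ∑ x, π x * ((P *ᵥ f) x ^ 2 + 1 / 2 * ∑ y, P x y * (f y - f x) ^ 2)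
      ≤ ∑ x, π x * (P *ᵥ (fun y => f y ^ 2)) x :=
    Finset.sum_le_sum fun x _ =>
      mul_le_mul_of_nonneg_left (mulVec_sq_le_of_lazy P hP hrow hlazy f x) (hπ x)
  rw [sum_mul_mulVec_of_stationary P π hπP] at h1
  have h2 : ∑ x, π x * ((P *ᵥ f) x ^ 2 + 1 / 2 * ∑ y, P x y * (f y - f x) ^ 2)
      = ∑ x, π x * (P *ᵥ f) x ^ 2 + dirichletForm P π f := by
    simp_rw [mul_add, Finset.sum_add_distrib, dirichletForm, Finset.mul_sum]
    congr 1
    exact Finset.sum_congr rfl fun x _ => Finset.sum_congr rfl fun y _ => by ring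
  unfold weightedVariance
  rw [sum_mul_mulVec_of_stationary P π hπP]
  linarith

theorem weightedVariance_pow_mulVec_le [DecidableEq Ω] (P : Matrix Ω Ω ℝ) (π : Ω → ℝ)
    (hπ : ∀ x, 0 ≤ π x) (hπP : π ᵥ* P = π) (hP : ∀ x y, 0 ≤ P x y)
    (hrow : ∀ x, ∑ y, P x y = 1) (hlazy : ∀ x, 1 / 2 ≤ P x x) (C : ℝ) (hC : 1 ≤ C)
    (hgap : ∀ f, weightedVariance π f ≤ C * dirichletForm P π f) (f : Ω → ℝ) (t : ℕ) :
    weightedVariance π (P ^ t *ᵥ f) ≤ (1 - 1 / C) ^ t * weightedVariance π f := by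
  have hC0 : 0 < C := by linarith
  induction t with
  | zero => simp
  | succ t ih =>
    have h1 : 0 ≤ 1 - 1 / C := by
      rw [sub_nonneg, div_le_one hC0]; exact hC
    rw [pow_succ' P, ← Matrix.mulVec_mulVec]
    set g := P ^ t *ᵥ f
    have h2 := weightedVariance_mulVec_add_dirichletForm_le P π hπ hπP hP hrow hlazy g
    have h3 : weightedVariance π g / C ≤ dirichletForm P π g := by
      rw [div_le_iff₀' hC0]; exact hgap g
    calc weightedVariance π (P *ᵥ g) ≤ (1 - 1 / C) * weightedVariance π g := by
          have : (1 - 1 / C) * weightedVariance π g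
            = weightedVariance π g - weightedVariance π g / C := by ring
          linarith
      _ ≤ (1 - 1 / C) * ((1 - 1 / C) ^ t * weightedVariance π f) :=
          mul_le_mul_of_nonneg_left ih h1
      _ = _ := by ring

theorem vecMul_eq_of_reversible (P : Matrix Ω Ω ℝ) (π : Ω → ℝ)
    (hrev : ∀ x y, π x * P x y = π y * P y x) (hrow : ∀ x, ∑ y, P x y = 1) : π ᵥ* P = π := by
  ext y
  simp only [Matrix.vecMul, dotProduct, fun x => hrev x y, ← Finset.mul_sum, hrow, mul_one]

theorem pow_reversible [DecidableEq Ω] (P : Matrix Ω Ω ℝ) (π : Ω → ℝ)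
    (hrev : ∀ x y, π x * P x y = π y * P y x) (t : ℕ) (x y : Ω) :
    π x * (P ^ t) x y = π y * (P ^ t) y x := by
  induction t generalizing x y with
  | zero =>
    rcases eq_or_ne x y with rfl | h
    · rfl
    · simp [Matrix.one_apply_ne h, Matrix.one_apply_ne h.symm]
  | succ t ih =>
    rw [pow_succ, Matrix.mul_apply, ← pow_succ, pow_succ', Matrix.mul_apply, Finset.mul_sum,
      Finset.mul_sum]
    refine Finset.sum_congr rfl fun z _ => ?_
    rw [← mul_assoc, ih, mul_right_comm, hrev z y]
    ring

/-- By reversibility the density of `P ^ t` started at `x` is `P ^ t` applied to the normalized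
point mass at `x`, whose variance is at most `1 / π x`. Cauchy–Schwarz bounds the `L¹` distance by
the `L²` distance, which is the variance of that density. -/
theorem sq_sum_abs_pow_sub_le [DecidableEq Ω] (P : Matrix Ω Ω ℝ) (π : Ω → ℝ)
    (hπ : ∀ x, 0 < π x) (hsum : ∑ x, π x = 1) (hrev : ∀ x y, π x * P x y = π y * P y x)
    (hP : ∀ x y, 0 ≤ P x y) (hrow : ∀ x, ∑ y, P x y = 1) (hlazy : ∀ x, 1 / 2 ≤ P x x)
    (C : ℝ) (hC : 1 ≤ C) (hgap : ∀ f, weightedVariance π f ≤ C * dirichletForm P π f)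
    (t : ℕ) (x : Ω) :
    (∑ y, |(P ^ t) x y - π y|) ^ 2 ≤ (1 - 1 / C) ^ t * (1 / π x) := by
  have hπP := vecMul_eq_of_reversible P π hrev hrow
  have hπ0 : ∀ x, 0 ≤ π x := fun x => (hπ x).le
  set f : Ω → ℝ := Pi.single x (1 / π x) with hf
  have hPf : ∀ y, (P ^ t) x y = π y * (P ^ t *ᵥ f) y := by
    intro y
    rw [hf, Matrix.mulVec_single]
    have := pow_reversible P π hrev t x y
    have := (hπ x).ne'
    simp only [Pi.smul_apply, Matrix.col_apply, MulOpposite.smul_eq_mul_unop, MulOpposite.unop_op]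
    field_simp
    linarith
  have hmean : ∀ s : ℕ, ∑ y, π y * (P ^ s *ᵥ f) y = 1 := by
    intro s
    induction s with
    | zero =>
      simp only [pow_zero, Matrix.one_mulVec, hf]
      rw [Finset.sum_eq_single x]
      · have := (hπ x).ne'
        simp [this]
      · intro b _ hb; simp [Pi.single_eq_of_ne hb]
      · simp
    | succ s ih =>
      rw [pow_succ', ← Matrix.mulVec_mulVec, sum_mul_mulVec_of_stationary P π hπP, ih]
  set g := P ^ t *ᵥ f with hg
  have h1 : ∑ y, |(P ^ t) x y - π y| = ∑ y, π y * |g y - 1| := by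
    refine Finset.sum_congr rfl fun y _ => ?_
    rw [hPf, ← mul_sub_one, abs_mul, abs_of_pos (hπ y)]
  have h2 : (∑ y, π y * |g y - 1|) ^ 2 ≤ (∑ y, π y) * ∑ y, π y * (g y - 1) ^ 2 :=
    Finset.sum_sq_le_sum_mul_sum_of_sq_le_mul _ (fun y _ => hπ0 y)
      (fun y _ => mul_nonneg (hπ0 y) (sq_nonneg _)) (fun y _ => le_of_eq (by rw [mul_pow, sq_abs]; ring))
  have h3 : ∑ y, π y * (g y - 1) ^ 2 = weightedVariance π g := by
    have : ∀ y, π y * (g y - 1) ^ 2 = π y * g y ^ 2 - 2 * (π y * g y) + π y := fun y => by ring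
    rw [Finset.sum_congr rfl fun y _ => this y, Finset.sum_add_distrib, Finset.sum_sub_distrib,
      ← Finset.mul_sum, weightedVariance, hsum, hmean t]
    ring
  have h4 : weightedVariance π f ≤ 1 / π x := by
    have : ∑ y, π y * f y ^ 2 = 1 / π x := by
      rw [Finset.sum_eq_single x]
      · have := (hπ x).ne'
        simp [hf]; field_simp
      · intro b _ hb; simp [hf, Pi.single_eq_of_ne hb]
      · simp
    unfold weightedVariance
    rw [this]
    linarith [sq_nonneg (∑ x, π x * f x)]
  have h0 : 0 ≤ 1 - 1 / C := by
    rw [sub_nonneg, div_le_one (by linarith)]; exact hC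
  rw [h1]
  calc _ ≤ _ := h2
    _ = weightedVariance π g := by rw [hsum, one_mul, h3]
    _ ≤ _ := weightedVariance_pow_mulVec_le P π hπ0 hπP hP hrow hlazy C hC hgap f t
    _ ≤ _ := mul_le_mul_of_nonneg_left h4 (pow_nonneg h0 t)

theorem sum_abs_pow_sub_le_of_le [DecidableEq Ω] (P : Matrix Ω Ω ℝ) (π : Ω → ℝ)
    (hπ : ∀ x, 0 < π x) (hsum : ∑ x, π x = 1) (hrev : ∀ x y, π x * P x y = π y * P y x)
    (hP : ∀ x y, 0 ≤ P x y) (hrow : ∀ x, ∑ y, P x y = 1) (hlazy : ∀ x, 1 / 2 ≤ P x x)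
    (C : ℝ) (hC : 1 ≤ C) (hgap : ∀ f, weightedVariance π f ≤ C * dirichletForm P π f)
    (K : ℝ) (t : ℕ) (ht : C * (2 + K) ≤ t) (x : Ω) (hK : Real.log (1 / π x) ≤ K) :
    ∑ y, |(P ^ t) x y - π y| ≤ 1 / Real.exp 1 := by
  have hC0 : 0 < C := by linarith
  have h0 : 0 ≤ 1 - 1 / C := by
    rw [sub_nonneg, div_le_one hC0]; exact hC
  have hx : 0 < 1 / π x := one_div_pos.mpr (hπ x)
  refine abs_le_of_sq_le_sq' ?_ (by positivity) |>.2
  refine (sq_sum_abs_pow_sub_le P π hπ hsum hrev hP hrow hlazy C hC hgap t x).trans ?_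
  calc (1 - 1 / C) ^ t * (1 / π x) ≤ Real.exp (-(1 / C)) ^ t * Real.exp K := by
        gcongr
        · have := Real.add_one_le_exp (-(1 / C)); linarith
        · rwa [← Real.log_le_iff_le_exp hx]
    _ = Real.exp (-(t / C) + K) := by
        rw [← Real.exp_nat_mul, ← Real.exp_add]; congr 1; ring
    -- The `2` in `2 + K` yields `exp (-2)`, the square of the target `1 / e`.
    _ ≤ Real.exp (-2) := by
        have : 2 + K ≤ t / C := by rw [le_div_iff₀ hC0]; linarith
        exact Real.exp_le_exp.mpr (by linarith)
    _ = (1 / Real.exp 1) ^ 2 := by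
        rw [one_div, ← Real.exp_neg, ← Real.exp_nat_mul]; norm_num

/-- The density `ν / π` is harmonic by reversibility. The variance inequality then forces its
Dirichlet form to vanish, and the gap bound makes it constant. -/
theorem eq_of_isStationaryDistribution (P : Matrix Ω Ω ℝ) (π : Ω → ℝ)
    (hπ : ∀ x, 0 < π x) (hsum : ∑ x, π x = 1) (hrev : ∀ x y, π x * P x y = π y * P y x)
    (hP : ∀ x y, 0 ≤ P x y) (hrow : ∀ x, ∑ y, P x y = 1) (hlazy : ∀ x, 1 / 2 ≤ P x x)
    (C : ℝ) (hgap : ∀ f, weightedVariance π f ≤ C * dirichletForm P π f)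
    (ν : Ω → ℝ) (hν : IsStationaryDistribution P ν) : ν = π := by
  have hπP := vecMul_eq_of_reversible P π hrev hrow
  set f : Ω → ℝ := fun x => ν x / π x with hf
  have hfix : P *ᵥ f = f := by
    ext x
    have h1 : ∀ y, P x y * f y = ν y * P y x / π x := by
      intro y
      have := (hπ x).ne'
      have := (hπ y).ne'
      have := hrev x y
      simp only [hf]
      field_simp
      linear_combination ν y * this
    simp only [Matrix.mulVec, dotProduct, h1, ← Finset.sum_div]
    exact congrArg (· / π x) (congrFun hν.2 x)
  have hD0 : dirichletForm P π f ≤ 0 := by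
    have := weightedVariance_mulVec_add_dirichletForm_le P π (fun x => (hπ x).le) hπP hP hrow
      hlazy f
    rw [hfix] at this
    linarith
  have hD : dirichletForm P π f = 0 := by
    refine le_antisymm hD0 ?_
    refine mul_nonneg (by norm_num) (Finset.sum_nonneg fun x _ => Finset.sum_nonneg fun y _ => ?_)
    exact mul_nonneg (mul_nonneg (hπ x).le (hP x y)) (sq_nonneg _)
  have hV := hgap f
  rw [hD, mul_zero] at hV
  have hS := sum_sum_mul_sub_sq π f hsum
  have hnn : ∀ x y, 0 ≤ π x * π y * (f y - f x) ^ 2 := fun x y =>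
    mul_nonneg (mul_nonneg (hπ x).le (hπ y).le) (sq_nonneg _)
  have hS0 : ∑ x, ∑ y, π x * π y * (f y - f x) ^ 2 = 0 :=
    le_antisymm (by linarith) (Finset.sum_nonneg fun x _ => Finset.sum_nonneg fun y _ => hnn x y)
  have hconst : ∀ x y, f y = f x := by
    intro x y
    rw [Finset.sum_eq_zero_iff_of_nonneg
      (fun x _ => Finset.sum_nonneg fun y _ => hnn x y)] at hS0
    have h1 := hS0 x (Finset.mem_univ x)
    rw [Finset.sum_eq_zero_iff_of_nonneg (fun y _ => hnn x y)] at h1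
    have h2 := h1 y (Finset.mem_univ y)
    have h3 := (mul_pos (hπ x) (hπ y)).ne'
    have h4 := pow_eq_zero_iff (two_ne_zero) |>.mp ((mul_eq_zero.mp h2).resolve_left h3)
    linarith
  ext x
  have h1 : ∀ y, ν y = f x * π y := by
    intro y
    rw [← hconst x y]
    have := (hπ y).ne'
    simp only [hf]; field_simp
  have h2 : ∑ y, ν y = 1 := hν.1.2
  simp_rw [h1, ← Finset.mul_sum, hsum, mul_one] at h2
  rw [h1, h2, one_mul]

theorem exists_pow_pos_trans [DecidableEq Ω] (P : Matrix Ω Ω ℝ) (hP : ∀ x y, 0 ≤ P x y)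
    {x y z : Ω} (hxy : ∃ t : ℕ, 0 < (P ^ t) x y) (hyz : 0 < P y z) :
    ∃ t : ℕ, 0 < (P ^ t) x z := by
  obtain ⟨t, ht⟩ := hxy
  refine ⟨t + 1, ?_⟩
  have hPt : ∀ (s : ℕ) (x y : Ω), 0 ≤ (P ^ s) x y := by
    intro s
    induction s with
    | zero => intro x y; rw [pow_zero, Matrix.one_apply]; split_ifs <;> norm_num
    | succ s ih =>
      intro x y
      rw [pow_succ, Matrix.mul_apply]
      exact Finset.sum_nonneg fun z _ => mul_nonneg (ih x z) (hP z y)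
  rw [pow_succ, Matrix.mul_apply]
  exact Finset.sum_pos' (fun w _ => mul_nonneg (hPt t x w) (hP w z))
    ⟨y, Finset.mem_univ y, mul_pos ht hyz⟩

end LazyChain

namespace RandomCluster

/-! ### Component counts as dimensions of function spaces. -/

section Components

variable {V : Type*} (G : SimpleGraph V)

/-- The functions on the vertices that agree at the two endpoints of every edge of `A`. -/
def edgeConstant (A : State G) : Submodule ℝ (V → ℝ) where
  carrier := {f | ∀ e ∈ A, ∀ u ∈ (e : Sym2 V), ∀ v ∈ (e : Sym2 V), f u = f v}
  add_mem' := by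
    intro f g hf hg e he u hu v hv
    simp only [Pi.add_apply]
    rw [hf e he u hu v hv, hg e he u hu v hv]
  zero_mem' := by
    intro e _ u _ v _
    rfl
  smul_mem' := by
    intro c f hf e he u hu v hv
    simp only [Pi.smul_apply]
    rw [hf e he u hu v hv]

theorem mem_edgeConstant {A : State G} {f : V → ℝ} :
    f ∈ edgeConstant G A ↔ ∀ e ∈ A, ∀ u ∈ (e : Sym2 V), ∀ v ∈ (e : Sym2 V), f u = f v :=
  Iff.rfl

theorem subgraph_adj {A : State G} {u v : V} :
    (subgraph G A).Adj u v ↔ ∃ e ∈ A, (e : Sym2 V) = s(u, v) := by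
  simp only [subgraph, SimpleGraph.fromEdgeSet_adj, Set.mem_image, Finset.mem_coe]
  refine ⟨fun h => h.1, fun ⟨e, he, h⟩ => ⟨⟨e, he, h⟩, ?_⟩⟩
  have := e.2
  rw [h, SimpleGraph.mem_edgeSet] at this
  exact this.ne

theorem eq_of_mem_edgeConstant_of_reachable {A : State G} {f : V → ℝ}
    (hf : f ∈ edgeConstant G A) {u v : V} (h : (subgraph G A).Reachable u v) : f u = f v := by
  obtain ⟨w⟩ := h
  induction w with
  | nil => rfl
  | cons hadj _ ih =>
    obtain ⟨e, he, h⟩ := (subgraph_adj G).mp hadj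
    rw [← ih]
    exact hf e he _ (by simp [h]) _ (by simp [h])

theorem reachable_of_mem_edge {A : State G} {e : G.edgeSet} (he : e ∈ A) {u v : V}
    (hu : u ∈ (e : Sym2 V)) (hv : v ∈ (e : Sym2 V)) : (subgraph G A).Reachable u v := by
  rcases eq_or_ne u v with rfl | hne
  · exact SimpleGraph.Reachable.refl u
  · exact SimpleGraph.Adj.reachable
      ((subgraph_adj G).mpr ⟨e, he, (Sym2.mem_and_mem_iff hne).mp ⟨hu, hv⟩⟩)

theorem endsConnected_of_mem {A : State G} {e : G.edgeSet} (he : e ∈ A) : EndsConnected G A e :=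
  fun _ hu _ hv => reachable_of_mem_edge G he hu hv

/-- A function that is constant along edges is a function on connected components. -/
noncomputable def componentFunctionEquiv (A : State G) :
    ((subgraph G A).ConnectedComponent → ℝ) ≃ₗ[ℝ] edgeConstant G A where
  toFun g := ⟨fun v => g ((subgraph G A).connectedComponentMk v), by
    intro e he u hu v hv
    exact congrArg g (SimpleGraph.ConnectedComponent.eq.mpr (reachable_of_mem_edge G he hu hv))⟩
  map_add' _ _ := rfl
  map_smul' _ _ := rfl
  invFun f := fun c => c.lift f.1 fun _ _ p _ => eq_of_mem_edgeConstant_of_reachable G f.2 ⟨p⟩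
  left_inv g := by
    ext c
    induction c using SimpleGraph.ConnectedComponent.ind
    rfl
  right_inv f := rfl

theorem edgeConstant_union [DecidableEq G.edgeSet] (A B : State G) :
    edgeConstant G (A ∪ B) = edgeConstant G A ⊓ edgeConstant G B := by
  ext f
  simp only [Submodule.mem_inf, mem_edgeConstant, Finset.mem_union, or_imp, forall_and]

variable [Fintype V]

theorem finrank_edgeConstant (A : State G) :
    Module.finrank ℝ (edgeConstant G A) = numComponents G A := by
  classical
  have : Fintype (subgraph G A).ConnectedComponent := Fintype.ofFinite _
  rw [← (componentFunctionEquiv G A).finrank_eq, Module.finrank_fintype_fun_eq_card,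
    numComponents, Nat.card_eq_fintype_card]

theorem numComponents_le_card (A : State G) : numComponents G A ≤ Fintype.card V := by
  rw [← finrank_edgeConstant]
  exact (Submodule.finrank_le _).trans_eq (Module.finrank_fintype_fun_eq_card ℝ)

/-- The functions that are constant on `W`. -/
def constantOn (W : Finset V) : Submodule ℝ (V → ℝ) where
  carrier := {f | ∀ u ∈ W, ∀ v ∈ W, f u = f v}
  add_mem' := by
    intro f g hf hg u hu v hv
    simp only [Pi.add_apply]
    rw [hf u hu v hv, hg u hu v hv]
  zero_mem' := by
    intro u _ v _
    rfl
  smul_mem' := by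
    intro c f hf u hu v hv
    simp only [Pi.smul_apply]
    rw [hf u hu v hv]

/-- Constancy on `W` is imposed by the `|W| - 1` equations `f v = f w` for a base point `w`;
nonemptiness is what gains the `1`. -/
theorem card_add_one_le_finrank_constantOn {W : Finset V} (hW : W.Nonempty) :
    Fintype.card V + 1 ≤ Module.finrank ℝ (constantOn W) + W.card := by
  classical
  obtain ⟨w, hw⟩ := hW
  let φ : (V → ℝ) →ₗ[ℝ] (W.erase w → ℝ) :=
    LinearMap.pi fun v =>
      (LinearMap.proj (v : V) : (V → ℝ) →ₗ[ℝ] ℝ) - LinearMap.proj w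
  have hker : LinearMap.ker φ ≤ constantOn W := by
    intro f hf
    have h : ∀ v ∈ W, f v = f w := by
      intro v hv
      rcases eq_or_ne v w with rfl | hne
      · rfl
      · have := congrFun (LinearMap.mem_ker.mp hf) ⟨v, Finset.mem_erase.mpr ⟨hne, hv⟩⟩
        exact sub_eq_zero.mp this
    intro u hu v hv
    rw [h u hu, h v hv]
  have h1 := LinearMap.finrank_range_add_finrank_ker φ
  have h2 : Module.finrank ℝ (LinearMap.range φ) ≤ W.card - 1 := by
    refine (Submodule.finrank_le _).trans_eq ?_
    rw [Module.finrank_fintype_fun_eq_card, Fintype.card_coe, Finset.card_erase_of_mem hw]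
  have h3 := Submodule.finrank_mono hker
  have h4 : 0 < W.card := Finset.card_pos.mpr ⟨w, hw⟩
  rw [Module.finrank_fintype_fun_eq_card] at h1
  omega

theorem constantOn_le_sup {S : Set G.edgeSet} {W : Finset V} (A B : State G)
    (hA : ∀ e ∈ A, e ∈ S) (hB : ∀ e ∈ B, e ∉ S)
    (hW : ∀ e ∈ S, ∀ e' ∉ S, ∀ v, v ∈ (e : Sym2 V) → v ∈ (e' : Sym2 V) → v ∈ W) :
    constantOn W ≤ edgeConstant G A ⊔ edgeConstant G B := by
  classical
  intro f hf
  obtain ⟨k, hk⟩ : ∃ k, ∀ v ∈ W, f v = k := by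
    rcases W.eq_empty_or_nonempty with rfl | ⟨w, hw⟩
    · exact ⟨0, by simp⟩
    · exact ⟨f w, fun v hv => hf v hv w hw⟩
  -- Split `f` as `g + (f - g)`, with `g` equal to `k` on every vertex touched by `S` and to `f`
  -- elsewhere. An end of an edge outside `S` that is touched lies in `W`, where `f = k`, so `f - g`
  -- vanishes on all ends of edges of `B`.
  let touch : V → Prop := fun v => ∃ e ∈ S, v ∈ (e : Sym2 V)
  let g : V → ℝ := fun v => if touch v then k else f v
  have hg : g ∈ edgeConstant G A := by
    intro e he u hu v hv
    have h1 : touch u := ⟨e, hA e he, hu⟩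
    have h2 : touch v := ⟨e, hA e he, hv⟩
    simp [g, h1, h2]
  have hfg : f - g ∈ edgeConstant G B := by
    have h0 : ∀ e ∈ B, ∀ v ∈ (e : Sym2 V), (f - g) v = 0 := by
      intro e he v hv
      by_cases h : touch v
      · obtain ⟨e', he', hv'⟩ := h
        have h1 : touch v := ⟨e', he', hv'⟩
        simp [g, h1, hk v (hW e' he' e (hB e he) v hv' hv)]
      · simp [g, h]
    intro e he u hu v hv
    rw [h0 e he u hu, h0 e he v hv]
  rw [← add_sub_cancel g f]
  exact Submodule.add_mem_sup hg hfg

/-- Exchanging the parts inside `S` of two configurations changes the total number of components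
by less than the number of vertices that meet both `S` and its complement. -/
theorem numComponents_exchange [DecidableEq G.edgeSet] (S : Set G.edgeSet) (W : Finset V)
    (hWne : W.Nonempty)
    (hW : ∀ e ∈ S, ∀ e' ∉ S, ∀ v, v ∈ (e : Sym2 V) → v ∈ (e' : Sym2 V) → v ∈ W)
    (A₁ A₂ B₁ B₂ : State G) (hA₁ : ∀ e ∈ A₁, e ∈ S) (hB₁ : ∀ e ∈ B₁, e ∈ S)
    (hA₂ : ∀ e ∈ A₂, e ∉ S) (hB₂ : ∀ e ∈ B₂, e ∉ S) :
    numComponents G (A₁ ∪ A₂) + numComponents G (B₁ ∪ B₂) + 1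
      ≤ W.card + (numComponents G (B₁ ∪ A₂) + numComponents G (A₁ ∪ B₂)) := by
  simp only [← finrank_edgeConstant]
  rw [edgeConstant_union, edgeConstant_union, edgeConstant_union, edgeConstant_union]
  have hN1 := constantOn_le_sup G A₁ A₂ hA₁ hA₂ hW
  have hN2 := constantOn_le_sup G B₁ B₂ hB₁ hB₂ hW
  set a₁ := edgeConstant G A₁
  set a₂ := edgeConstant G A₂
  set b₁ := edgeConstant G B₁
  set b₂ := edgeConstant G B₂
  set N := constantOn W
  have h1 := Submodule.finrank_sup_add_finrank_inf_eq a₁ a₂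
  have h2 := Submodule.finrank_sup_add_finrank_inf_eq b₁ b₂
  have h3 := Submodule.finrank_sup_add_finrank_inf_eq b₁ a₂
  have h4 := Submodule.finrank_sup_add_finrank_inf_eq a₁ b₂
  -- The first four formulas trade intersections for sums. This one bounds the two matched sums
  -- below by `dim (b₁ ⊔ a₂) + dim N`; with `dim (a₁ ⊔ b₂) ≤ |V|` the discrepancy is at most `|V| -
  -- dim N ≤ |W| - 1`.
  have h5 := Submodule.finrank_sup_add_finrank_inf_eq (b₁ ⊔ b₂) (a₁ ⊔ a₂)
  have h6 : Module.finrank ℝ N ≤ Module.finrank ℝ ↥((b₁ ⊔ b₂) ⊓ (a₁ ⊔ a₂)) :=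
    Submodule.finrank_mono (le_inf hN2 hN1)
  have h7 : Module.finrank ℝ ↥(b₁ ⊔ a₂) ≤ Module.finrank ℝ ↥((b₁ ⊔ b₂) ⊔ (a₁ ⊔ a₂)) :=
    Submodule.finrank_mono (sup_le_sup le_sup_left le_sup_right)
  have h8 : Module.finrank ℝ ↥(a₁ ⊔ b₂) ≤ Fintype.card V :=
    (Submodule.finrank_le _).trans_eq (Module.finrank_fintype_fun_eq_card ℝ)
  have h9 : Fintype.card V + 1 ≤ Module.finrank ℝ N + W.card :=
    card_add_one_le_finrank_constantOn hWne
  omega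

theorem numComponents_insert_le [DecidableEq G.edgeSet] (A : State G) (e : G.edgeSet) :
    numComponents G (insert e A) ≤ numComponents G A := by
  rw [← finrank_edgeConstant, ← finrank_edgeConstant]
  exact Submodule.finrank_mono fun f hf e' he' => hf e' (Finset.mem_insert_of_mem he')

theorem numComponents_insert_of_endsConnected [DecidableEq G.edgeSet] (A : State G)
    (e : G.edgeSet) (h : EndsConnected G A e) :
    numComponents G (insert e A) = numComponents G A := by
  have heq : edgeConstant G (insert e A) = edgeConstant G A := ?_
  · rw [← finrank_edgeConstant, ← finrank_edgeConstant, heq]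
  refine le_antisymm (fun f hf e' he' => hf e' (Finset.mem_insert_of_mem he')) ?_
  intro f hf e' he' u hu v hv
  rcases Finset.mem_insert.mp he' with rfl | he'
  · exact eq_of_mem_edgeConstant_of_reachable G hf (h u hu v hv)
  · exact hf e' he' u hu v hv

/-- A new edge imposes a single linear equation `f u = f v`. -/
theorem numComponents_le_insert_add_one [DecidableEq G.edgeSet] (A : State G) (e : G.edgeSet) :
    numComponents G A ≤ numComponents G (insert e A) + 1 := by
  rw [← finrank_edgeConstant, ← finrank_edgeConstant]
  obtain ⟨⟨u, v⟩, he⟩ := Quot.exists_rep (e : Sym2 V)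
  replace he : (e : Sym2 V) = s(u, v) := he.symm
  let φ : edgeConstant G A →ₗ[ℝ] ℝ :=
    ((LinearMap.proj u : (V → ℝ) →ₗ[ℝ] ℝ) - LinearMap.proj v) ∘ₗ (edgeConstant G A).subtype
  have h1 := LinearMap.finrank_range_add_finrank_ker φ
  have h2 : Module.finrank ℝ (LinearMap.range φ) ≤ 1 :=
    (Submodule.finrank_le _).trans_eq (Module.finrank_self ℝ)
  have h3 : (LinearMap.ker φ).map (edgeConstant G A).subtype ≤ edgeConstant G (insert e A) := by
    rintro _ ⟨f, hf, rfl⟩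
    have huv : f.1 u = f.1 v := sub_eq_zero.mp (LinearMap.mem_ker.mp hf)
    intro e' he' x hx y hy
    rcases Finset.mem_insert.mp he' with rfl | he'
    · rw [he, Sym2.mem_iff] at hx hy
      rcases hx with rfl | rfl <;> rcases hy with rfl | rfl <;> simp [huv]
    · exact f.2 e' he' x hx y hy
  have h4 := Submodule.finrank_mono h3
  rw [Submodule.finrank_map_subtype_eq] at h4
  omega

/-- The indicator of the component of one endpoint is constant along `A` but not along `e`, so the
inclusion of spaces is strict. -/
theorem numComponents_of_not_endsConnected [DecidableEq G.edgeSet] (A : State G)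
    (e : G.edgeSet) (h : ¬ EndsConnected G A e) :
    numComponents G A = numComponents G (insert e A) + 1 := by
  refine le_antisymm (numComponents_le_insert_add_one G A e) ?_
  rw [← finrank_edgeConstant, ← finrank_edgeConstant, Nat.add_one_le_iff]
  refine Submodule.finrank_lt_finrank_of_lt (lt_of_le_of_ne
    (fun f hf e' he' => hf e' (Finset.mem_insert_of_mem he')) fun heq => h ?_)
  classical
  intro u hu v hv
  by_contra hr
  let f : V → ℝ := fun x => if (subgraph G A).Reachable u x then 1 else 0
  have hf : f ∈ edgeConstant G A := by
    intro e' he' x hx y hy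
    have hxy := reachable_of_mem_edge G he' hx hy
    have : (subgraph G A).Reachable u x ↔ (subgraph G A).Reachable u y :=
      ⟨fun h => h.trans hxy, fun h => h.trans hxy.symm⟩
    simp only [f, this]
  rw [← heq] at hf
  have := hf e (Finset.mem_insert_self e A) u hu v hv
  simp [f, hr] at this

end Components

end RandomCluster

namespace RandomCluster

/-! ### Splicing configurations and the exchange involution. -/

section Splice

variable {ι : Type*} [DecidableEq ι]

/-- The configuration that agrees with `C` inside `S` and with `D` outside `S`. -/
def splice (S C D : Finset ι) : Finset ι := (C ∩ S) ∪ (D \ S)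

theorem mem_splice {S C D : Finset ι} {e : ι} :
    e ∈ splice S C D ↔ (e ∈ C ∧ e ∈ S) ∨ (e ∈ D ∧ e ∉ S) := by
  simp [splice]

theorem splice_splice_left (S C D : Finset ι) :
    splice S (splice S C D) (splice S D C) = C := by
  ext e; simp only [mem_splice]; tauto

theorem insert_splice {S : Finset ι} {e : ι} (C D : Finset ι) :
    insert e (splice S C D) = splice S (insert e C) (insert e D) := by
  ext x; simp only [mem_splice, Finset.mem_insert]; tauto

theorem card_splice_add_card_splice (S C D : Finset ι) :
    (splice S C D).card + (splice S D C).card = C.card + D.card := by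
  have h : ∀ C D : Finset ι, (splice S C D).card = (C ∩ S).card + (D \ S).card := by
    intro C D
    refine Finset.card_union_of_disjoint (Finset.disjoint_left.mpr fun x h1 h2 => ?_)
    exact (Finset.mem_sdiff.mp h2).2 (Finset.mem_inter.mp h1).2
  rw [h, h, ← Finset.card_inter_add_card_sdiff C S, ← Finset.card_inter_add_card_sdiff D S]
  omega

/-- Exchanging the parts inside `S`, as an involution on pairs of configurations. -/
def exchangeEquiv (S : Finset ι) : (Finset ι × Finset ι) ≃ (Finset ι × Finset ι) where
  toFun x := (splice S x.2 x.1, splice S x.1 x.2)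
  invFun x := (splice S x.2 x.1, splice S x.1 x.2)
  left_inv x := Prod.ext (splice_splice_left S x.1 x.2) (splice_splice_left S x.2 x.1)
  right_inv x := Prod.ext (splice_splice_left S x.1 x.2) (splice_splice_left S x.2 x.1)

/-- The configuration `C` with the status of `e` reversed. -/
def flip (e : ι) (C : Finset ι) : Finset ι := if e ∈ C then C.erase e else insert e C

/-- In exchanged coordinates `(C, D)`, the path step at `e` starts from `C` and flips `e` exactly
when `C` and `D` disagree there. -/
theorem splice_insert_exchange {S : Finset ι} {e : ι} (he : e ∉ S) (C D : Finset ι) :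
    splice (insert e S) (splice S C D) (splice S D C)
      = if (e ∈ C ↔ e ∈ D) then C else flip e C := by
  ext x
  rcases eq_or_ne x e with rfl | hx
  · by_cases h1 : x ∈ C <;> by_cases h2 : x ∈ D <;>
      simp [mem_splice, flip, h1, h2, he]
  · by_cases h1 : e ∈ C <;> by_cases h2 : e ∈ D <;>
      simp only [mem_splice, flip, h1, h2, hx, Finset.mem_insert, Finset.mem_erase, if_true,
        if_false, false_or, true_iff, iff_true, not_false_iff, ne_eq, true_and] <;> tauto

theorem sum_filter_mem_eq_sum_insert [Fintype ι] (e : ι) (F : Finset ι → ℝ) :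
    ∑ D with e ∈ D, F D = ∑ D with e ∉ D, F (insert e D) := by
  refine Finset.sum_nbij' (fun D => D.erase e) (fun D => insert e D) ?_ ?_ ?_ ?_ ?_
  · intro D _; simp
  · intro D _; simp
  · intro D hD; exact Finset.insert_erase (Finset.mem_filter.mp hD).2
  · intro D hD; exact Finset.erase_insert (Finset.mem_filter.mp hD).2
  · intro D hD; rw [Finset.insert_erase (Finset.mem_filter.mp hD).2]

end Splice

/-! ### Single-edge updates, congestion of canonical paths and the gap. -/

section Dynamics

variable {V : Type*} (G : SimpleGraph V) (p : ℝ) (q : ℕ)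

open Classical in
/-- The probability that the update of `e` puts `e` into the configuration. -/
noncomputable def updateProb (A : State G) (e : G.edgeSet) : ℝ :=
  if EndsConnected G A e then p else p / q

variable {p q}

theorem updateProb_nonneg (hp0 : 0 < p) (A : State G) (e : G.edgeSet) :
    0 ≤ updateProb G p q A e := by
  unfold updateProb
  split_ifs <;> positivity

theorem div_natCast_le_self (hp0 : 0 < p) (hq : 1 ≤ q) : p / q ≤ p :=
  div_le_self hp0.le (by exact_mod_cast hq)

theorem updateProb_le (hp0 : 0 < p) (hq : 1 ≤ q) (A : State G) (e : G.edgeSet) :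
    updateProb G p q A e ≤ p := by
  unfold updateProb
  split_ifs
  · exact le_rfl
  · exact div_natCast_le_self hp0 hq

theorem updateProb_pos (hp0 : 0 < p) (hq : 1 ≤ q) (A : State G) (e : G.edgeSet) :
    0 < updateProb G p q A e := by
  have : (0 : ℝ) < q := by exact_mod_cast hq
  unfold updateProb
  split_ifs <;> positivity

theorem updateProb_of_mem {A : State G} {e : G.edgeSet} (he : e ∈ A) :
    updateProb G p q A e = p :=
  if_pos (endsConnected_of_mem G he)

theorem weight_pos (hp0 : 0 < p) (hp1 : p < 1) (hq : 1 ≤ q) (A : State G) :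
    0 < weight G p q A := by
  have : (0 : ℝ) < q := by exact_mod_cast hq
  have : 0 < 1 - p := by linarith
  unfold weight
  positivity

variable [DecidableEq V] (p q)

/-- The weight of `C` with the number of components computed as if `e` were present. -/
noncomputable def pinnedWeight (e : G.edgeSet) (C : State G) : ℝ :=
  (p / (1 - p)) ^ C.card * (q : ℝ) ^ numComponents G (insert e C)

theorem edgeUpdate_apply (e : G.edgeSet) (A B : State G) :
    edgeUpdate G p q e A B
      = (if B = insert e A then updateProb G p q A e else 0)
        + (if B = A.erase e then 1 - updateProb G p q A e else 0) := by
  have hne : insert e A ≠ A.erase e := fun h =>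
    Finset.notMem_erase e A (h ▸ Finset.mem_insert_self e A)
  have h1 : symmDiff A B ⊆ {e} ↔ B = insert e A ∨ B = A.erase e := by
    constructor
    · intro h
      have h' : ∀ x, x ≠ e → (x ∈ A ↔ x ∈ B) := by
        intro x hx
        by_contra hc
        refine hx (Finset.mem_singleton.mp (h ?_))
        rw [Finset.mem_symmDiff]
        tauto
      by_cases heB : e ∈ B
      · left
        ext x
        rcases eq_or_ne x e with rfl | hx
        · simp [heB]
        · simp [hx, h' x hx]
      · right
        ext x
        rcases eq_or_ne x e with rfl | hx
        · simp [heB]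
        · simp [hx, h' x hx]
    · rintro (rfl | rfl) x hx
      · rw [Finset.mem_symmDiff, Finset.mem_insert] at hx
        rw [Finset.mem_singleton]
        tauto
      · rw [Finset.mem_symmDiff, Finset.mem_erase] at hx
        rw [Finset.mem_singleton]
        tauto
  simp only [edgeUpdate, Matrix.of_apply, updateProb]
  by_cases hB1 : B = insert e A
  · subst hB1
    rw [if_pos (h1.mpr (Or.inl rfl)), if_pos rfl, if_neg hne, add_zero]
    simp
  · by_cases hB2 : B = A.erase e
    · subst hB2
      rw [if_pos (h1.mpr (Or.inr rfl)), if_neg hB1, if_pos rfl, zero_add]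
      simp only [Finset.notMem_erase, if_false]
      split_ifs <;> rfl
    · rw [if_neg (by tauto), if_neg hB1, if_neg hB2, add_zero]

variable {p q}

theorem edgeUpdate_nonneg (hp0 : 0 < p) (hp1 : p < 1) (hq : 1 ≤ q) (e : G.edgeSet)
    (A B : State G) : 0 ≤ edgeUpdate G p q e A B := by
  have h1 := updateProb_nonneg G (q := q) hp0 A e
  have h2 := updateProb_le G hp0 hq A e
  rw [edgeUpdate_apply]
  refine add_nonneg ?_ ?_ <;> split_ifs <;> linarith

theorem edgeUpdate_flip_pos (hp0 : 0 < p) (hp1 : p < 1) (hq : 1 ≤ q) (e : G.edgeSet)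
    (A : State G) : 0 < edgeUpdate G p q e A (flip e A) := by
  have h1 := updateProb_pos G hp0 hq A e
  have h2 := updateProb_le G hp0 hq A e
  rw [edgeUpdate_apply]
  unfold flip
  split_ifs <;> first | linarith | simp_all

section Weights

theorem pinnedWeight_nonneg (hp0 : 0 < p) (hp1 : p < 1) (e : G.edgeSet) (A : State G) :
    0 ≤ pinnedWeight G p q e A := by
  have : 0 < 1 - p := by linarith
  unfold pinnedWeight
  positivity

variable [Fintype V]

/-- This identity underlies detailed balance and the use of pinned weights: the factor `1 / q` in
the rate for unconnected endpoints compensates exactly for the component lost when `e` is added. -/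
theorem pow_numComponents_mul_updateProb (hq : 1 ≤ q) (A : State G) (e : G.edgeSet) :
    (q : ℝ) ^ numComponents G A * updateProb G p q A e
      = p * (q : ℝ) ^ numComponents G (insert e A) := by
  have hq0 : (q : ℝ) ≠ 0 := by exact_mod_cast (by omega : q ≠ 0)
  unfold updateProb
  split_ifs with h
  · rw [numComponents_insert_of_endsConnected G A e h, mul_comm]
  · rw [numComponents_of_not_endsConnected G A e h, pow_succ]
    field_simp

theorem weight_mul_edgeUpdate (hp1 : p < 1) (hq : 1 ≤ q) (e : G.edgeSet) {A : State G}
    (he : e ∉ A) :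
    weight G p q A * edgeUpdate G p q e A (insert e A)
      = weight G p q (insert e A) * edgeUpdate G p q e (insert e A) A := by
  have h1 : insert e A ≠ A.erase e := fun h =>
    Finset.notMem_erase e A (h ▸ Finset.mem_insert_self e A)
  have h2 : A ≠ insert e A := fun h => he (h ▸ Finset.mem_insert_self e A)
  have hp : 1 - p ≠ 0 := by linarith
  rw [edgeUpdate_apply, edgeUpdate_apply, if_pos rfl, if_neg h1, Finset.insert_idem, if_neg h2,
    Finset.erase_insert he, if_pos rfl, updateProb_of_mem G (Finset.mem_insert_self e A), add_zero,
    zero_add, weight, weight, mul_assoc, pow_numComponents_mul_updateProb G hq,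
    Finset.card_insert_of_notMem he, pow_succ]
  field_simp

theorem weight_mul_edgeUpdate_comm (hp1 : p < 1) (hq : 1 ≤ q) (e : G.edgeSet) (A B : State G) :
    weight G p q A * edgeUpdate G p q e A B = weight G p q B * edgeUpdate G p q e B A := by
  rcases eq_or_ne A B with rfl | hAB
  · rfl
  by_cases h1 : B = insert e A
  · subst h1
    refine weight_mul_edgeUpdate G hp1 hq e fun h => hAB ?_
    rw [Finset.insert_eq_of_mem h]
  by_cases h2 : B = A.erase e
  · have heA : e ∈ A := by
      by_contra h
      exact hAB (by rw [h2, Finset.erase_eq_of_notMem h])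
    have heB : e ∉ B := h2 ▸ Finset.notMem_erase e A
    have hA : A = insert e B := by rw [h2, Finset.insert_erase heA]
    subst hA
    exact (weight_mul_edgeUpdate G hp1 hq e heB).symm
  have h3 : A ≠ insert e B := by
    rintro rfl
    rcases Decidable.em (e ∈ B) with h | h
    · exact hAB (Finset.insert_eq_of_mem h)
    · exact h2 (Finset.erase_insert h).symm
  have h4 : A ≠ B.erase e := by
    rintro rfl
    rcases Decidable.em (e ∈ B) with h | h
    · exact h1 (Finset.insert_erase h).symm
    · exact hAB (Finset.erase_eq_of_notMem h)
  rw [edgeUpdate_apply, edgeUpdate_apply, if_neg h1, if_neg h2, if_neg h3, if_neg h4]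
  simp

end Weights

variable [Fintype V] [DecidableRel G.Adj]

theorem sum_edgeUpdate_mul (e : G.edgeSet) (A : State G) (F : State G → ℝ) :
    ∑ B, edgeUpdate G p q e A B * F B
      = updateProb G p q A e * F (insert e A) + (1 - updateProb G p q A e) * F (A.erase e) := by
  simp [edgeUpdate_apply, add_mul, Finset.sum_add_distrib, ite_mul]

theorem sum_edgeUpdate (e : G.edgeSet) (A : State G) : ∑ B, edgeUpdate G p q e A B = 1 := by
  simpa using sum_edgeUpdate_mul G (p := p) (q := q) e A fun _ => 1

theorem weight_mul_sum_edgeUpdate (hp1 : p < 1) (hq : 1 ≤ q) (e : G.edgeSet) (C : State G)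
    (f : State G → ℝ) :
    weight G p q C * ∑ B, edgeUpdate G p q e C B * (f B - f C) ^ 2
      = pinnedWeight G p q e C * (if e ∈ C then 1 - p else p) * (f (flip e C) - f C) ^ 2 := by
  have hp : 1 - p ≠ 0 := by linarith
  rw [sum_edgeUpdate_mul]
  by_cases he : e ∈ C
  · rw [Finset.insert_eq_of_mem he, updateProb_of_mem G he, if_pos he, flip, if_pos he, weight,
      pinnedWeight, Finset.insert_eq_of_mem he]
    ring
  · rw [Finset.erase_eq_of_notMem he, if_neg he, flip, if_neg he, weight, pinnedWeight, sub_self]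
    have := pow_numComponents_mul_updateProb G (p := p) hq C e
    linear_combination (p / (1 - p)) ^ C.card * (f (insert e C) - f C) ^ 2 * this

theorem partitionFunction_pos (hp0 : 0 < p) (hp1 : p < 1) (hq : 1 ≤ q) :
    0 < partitionFunction G p q :=
  Finset.sum_pos (fun A _ => weight_pos G hp0 hp1 hq A) Finset.univ_nonempty

theorem rcMeasure_pos (hp0 : 0 < p) (hp1 : p < 1) (hq : 1 ≤ q) (A : State G) :
    0 < rcMeasure G p q A :=
  div_pos (weight_pos G hp0 hp1 hq A) (partitionFunction_pos G hp0 hp1 hq)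

theorem sum_rcMeasure (hp0 : 0 < p) (hp1 : p < 1) (hq : 1 ≤ q) :
    ∑ A, rcMeasure G p q A = 1 := by
  simp only [rcMeasure, ← Finset.sum_div]
  exact div_self (partitionFunction_pos G hp0 hp1 hq).ne'

/-- Pinned weights with and without `e` are in the ratio `p : 1 - p`, and their total is at most `Z`
because pinning only merges components and `q ≥ 1`. The factor obtained is the update rate of `e`
from `C`, so no power of `p` is lost. -/
theorem sum_pinnedWeight_le (hp0 : 0 < p) (hp1 : p < 1) (hq : 1 ≤ q) (e : G.edgeSet)
    (C : State G) :
    ∑ D, (if (e ∈ C ↔ e ∈ D) then 0 else pinnedWeight G p q e D)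
      ≤ partitionFunction G p q * (if e ∈ C then 1 - p else p) := by
  have hp : 0 < 1 - p := by linarith
  have hq' : (1 : ℝ) ≤ q := by exact_mod_cast hq
  set Y := ∑ D with e ∉ D, pinnedWeight G p q e D with hY
  have h1 : ∑ D with e ∈ D, pinnedWeight G p q e D = p / (1 - p) * Y := by
    rw [sum_filter_mem_eq_sum_insert, hY, Finset.mul_sum]
    refine Finset.sum_congr rfl fun D hD => ?_
    rw [pinnedWeight, pinnedWeight, Finset.insert_idem,
      Finset.card_insert_of_notMem (Finset.mem_filter.mp hD).2]
    ring
  have h2 : p / (1 - p) * Y + Y ≤ partitionFunction G p q := by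
    rw [partitionFunction, ← Finset.sum_filter_add_sum_filter_not Finset.univ (e ∈ ·), ← h1]
    refine add_le_add (Finset.sum_le_sum fun D hD => ?_) (Finset.sum_le_sum fun D _ => ?_)
    · rw [pinnedWeight, Finset.insert_eq_of_mem (Finset.mem_filter.mp hD).2, weight]
    · have := numComponents_insert_le G D e
      unfold pinnedWeight weight
      gcongr
  have h3 : p / (1 - p) * Y + Y = Y / (1 - p) := by field_simp; ring
  rw [h3, div_le_iff₀ hp] at h2
  by_cases he : e ∈ C
  · simp only [he, true_iff, if_true]
    refine le_trans (le_of_eq ?_) h2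
    rw [hY, Finset.sum_filter]
    refine Finset.sum_congr rfl fun D _ => ?_
    by_cases h : e ∈ D <;> simp [h]
  · simp only [he, false_iff, if_false]
    have h4 : ∑ D, (if e ∉ D then 0 else pinnedWeight G p q e D) = p / (1 - p) * Y := by
      rw [← h1, Finset.sum_filter]
      refine Finset.sum_congr rfl fun D _ => ?_
      by_cases h : e ∈ D <;> simp [h]
    rw [h4, div_mul_eq_mul_div, div_le_iff₀ hp]
    nlinarith

/-- The contribution to the congestion of the canonical paths of the update of one edge. -/
theorem sum_sum_weight_mul_sub_sq_le (hp0 : 0 < p) (hp1 : p < 1) (hq : 1 ≤ q) (w : ℕ)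
    {S : State G} {e : G.edgeSet} (he : e ∉ S)
    (hS : ∀ C D : State G, numComponents G (splice S D C) + numComponents G (splice S C D) + 1
      ≤ w + (numComponents G C + numComponents G D)) (f : State G → ℝ) :
    ∑ A, ∑ B, weight G p q A * weight G p q B
        * (f (splice (insert e S) B A) - f (splice S B A)) ^ 2
      ≤ (q : ℝ) ^ w * partitionFunction G p q * ∑ C, pinnedWeight G p q e C
          * (if e ∈ C then 1 - p else p) * (f (flip e C) - f C) ^ 2 := by
  have hp : 0 < 1 - p := by linarith
  have hq' : (1 : ℝ) ≤ q := by exact_mod_cast hq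
  rw [← Fintype.sum_prod_type', ← (exchangeEquiv S).sum_comp, Fintype.sum_prod_type]
  simp only [exchangeEquiv, Equiv.coe_fn_mk, splice_splice_left, splice_insert_exchange he]
  have key : ∀ C D : State G,
      weight G p q (splice S D C) * weight G p q (splice S C D)
          * (f (if (e ∈ C ↔ e ∈ D) then C else flip e C) - f C) ^ 2
        ≤ (q : ℝ) ^ w * (pinnedWeight G p q e C * (f (flip e C) - f C) ^ 2)
          * (if (e ∈ C ↔ e ∈ D) then 0 else pinnedWeight G p q e D) := by
    intro C D
    by_cases hCD : (e ∈ C ↔ e ∈ D)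
    · simp [hCD]
    rw [if_neg hCD, if_neg hCD]
    -- Exactly one of the two splices contains `e`, so pinning `e` costs at most one component in
    -- total; the `+ 1` in `hS` pays for it.
    have hc : numComponents G (splice S D C) + numComponents G (splice S C D)
        ≤ w + (numComponents G (insert e C) + numComponents G (insert e D)) := by
      have h1 := hS (insert e C) (insert e D)
      rw [← insert_splice, ← insert_splice] at h1
      have h2 := numComponents_le_insert_add_one G (splice S D C) e
      have h3 := numComponents_le_insert_add_one G (splice S C D) e
      by_cases heC : e ∈ C
      · have : insert e (splice S D C) = splice S D C :=
          Finset.insert_eq_of_mem (mem_splice.mpr (Or.inr ⟨heC, he⟩))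
        rw [this] at h1
        omega
      · have : insert e (splice S C D) = splice S C D :=
          Finset.insert_eq_of_mem (mem_splice.mpr (Or.inr ⟨by tauto, he⟩))
        rw [this] at h1
        omega
    have hw : weight G p q (splice S D C) * weight G p q (splice S C D)
        ≤ (q : ℝ) ^ w * (pinnedWeight G p q e C * pinnedWeight G p q e D) := by
      calc weight G p q (splice S D C) * weight G p q (splice S C D)
          = (p / (1 - p)) ^ ((splice S D C).card + (splice S C D).card)
            * (q : ℝ) ^ (numComponents G (splice S D C) + numComponents G (splice S C D)) := by
            rw [weight, weight, pow_add, pow_add]; ring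
        _ ≤ (p / (1 - p)) ^ (D.card + C.card) * (q : ℝ) ^ (w + (numComponents G (insert e C)
            + numComponents G (insert e D))) := by
            rw [card_splice_add_card_splice]
            gcongr
        _ = _ := by
            rw [pinnedWeight, pinnedWeight, pow_add, pow_add, pow_add]; ring
    calc _ ≤ (q : ℝ) ^ w * (pinnedWeight G p q e C * pinnedWeight G p q e D)
          * (f (flip e C) - f C) ^ 2 := mul_le_mul_of_nonneg_right hw (sq_nonneg _)
      _ = _ := by ring
  refine (Finset.sum_le_sum fun C _ => Finset.sum_le_sum fun D _ => key C D).trans ?_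
  rw [Finset.mul_sum]
  refine Finset.sum_le_sum fun C _ => ?_
  rw [← Finset.mul_sum]
  have hnn : 0 ≤ (q : ℝ) ^ w * (pinnedWeight G p q e C * (f (flip e C) - f C) ^ 2) :=
    mul_nonneg (by positivity)
      (mul_nonneg (pinnedWeight_nonneg G hp0 hp1 e C) (sq_nonneg _))
  calc _ ≤ (q : ℝ) ^ w * (pinnedWeight G p q e C * (f (flip e C) - f C) ^ 2)
        * (partitionFunction G p q * (if e ∈ C then 1 - p else p)) :=
        mul_le_mul_of_nonneg_left (sum_pinnedWeight_le G hp0 hp1 hq e C) hnn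
    _ = _ := by ring

theorem dirichletForm_singleBond (hp1 : p < 1) (hq : 1 ≤ q) (f : State G → ℝ) :
    dirichletForm (singleBond G p q) (rcMeasure G p q) f
      = 1 / (4 * (Fintype.card G.edgeSet : ℝ)) / partitionFunction G p q
        * ∑ e : G.edgeSet, ∑ C, pinnedWeight G p q e C
          * (if e ∈ C then 1 - p else p) * (f (flip e C) - f C) ^ 2 := by
  simp_rw [← weight_mul_sum_edgeUpdate G hp1 hq]
  rw [Finset.sum_comm, dirichletForm, Finset.mul_sum, Finset.mul_sum]
  refine Finset.sum_congr rfl fun C _ => ?_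
  have h : ∀ B, rcMeasure G p q C * singleBond G p q C B * (f B - f C) ^ 2
      = 1 / (2 * (Fintype.card G.edgeSet : ℝ)) / partitionFunction G p q
        * ∑ e : G.edgeSet, weight G p q C * (edgeUpdate G p q e C B * (f B - f C) ^ 2) := by
    intro B
    rw [← Finset.mul_sum, ← Finset.sum_mul, rcMeasure, singleBond, Matrix.of_apply]
    by_cases hB : C = B
    · subst hB; simp
    · rw [if_neg hB]; ring
  have h2 : ∑ B, ∑ e : G.edgeSet, weight G p q C * (edgeUpdate G p q e C B * (f B - f C) ^ 2)
      = ∑ e : G.edgeSet, weight G p q C * ∑ B, edgeUpdate G p q e C B * (f B - f C) ^ 2 := by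
    rw [Finset.sum_comm]
    exact Finset.sum_congr rfl fun e _ => (Finset.mul_sum _ _ _).symm
  rw [Finset.sum_congr rfl fun B _ => h B, ← Finset.mul_sum, h2]
  ring

/-- The first `k` edges in the order `σ`. -/
def initialSegment {m : ℕ} (σ : Fin m ≃ G.edgeSet) (k : ℕ) : State G :=
  Finset.univ.filter fun e => (σ.symm e).val < k

theorem mem_initialSegment {m : ℕ} {σ : Fin m ≃ G.edgeSet} {k : ℕ} {e : G.edgeSet} :
    e ∈ initialSegment G σ k ↔ (σ.symm e).val < k := by
  simp [initialSegment]

theorem sub_eq_sum_splice_initialSegment {m : ℕ} (σ : Fin m ≃ G.edgeSet) (f : State G → ℝ)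
    (A B : State G) :
    f B - f A = ∑ k : Fin m, (f (splice (insert (σ k) (initialSegment G σ k)) B A)
      - f (splice (initialSegment G σ k) B A)) := by
  set S : ℕ → State G := initialSegment G σ with hS
  have h0 : splice (S 0) B A = A := by ext e; simp [S, mem_splice, mem_initialSegment]
  have hm : splice (S m) B A = B := by ext e; simp [S, mem_splice, mem_initialSegment]
  have hs : ∀ k : Fin m, S (k + 1) = insert (σ k) (S k) := by
    intro k
    ext e
    simp only [S, mem_initialSegment, Finset.mem_insert]
    rw [Nat.lt_succ_iff_lt_or_eq, or_comm, Fin.val_inj, Equiv.symm_apply_eq]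
  have h := Finset.sum_range_sub (fun k => f (splice (S k) B A)) m
  rw [h0, hm, Finset.sum_range] at h
  rw [← h]
  exact Finset.sum_congr rfl fun k _ => by rw [hs]

/-- The spectral gap bound for an order of the edges in which every vertex set separating an
initial segment from the rest has at most `w` vertices. -/
theorem weightedVariance_le_dirichletForm (hp0 : 0 < p) (hp1 : p < 1) (hq : 1 ≤ q) (w : ℕ)
    {m : ℕ} (σ : Fin m ≃ G.edgeSet)
    (hσ : ∀ k, ∃ W : Finset V, W.Nonempty ∧ W.card ≤ w ∧ ∀ e e' : G.edgeSet,
      σ.symm e < k → k ≤ σ.symm e' → ∀ v, v ∈ (e : Sym2 V) → v ∈ (e' : Sym2 V) → v ∈ W)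
    (f : State G → ℝ) :
    weightedVariance (rcMeasure G p q) f
      ≤ 2 * (m : ℝ) ^ 2 * (q : ℝ) ^ w
        * dirichletForm (singleBond G p q) (rcMeasure G p q) f := by
  have hm : Fintype.card G.edgeSet = m := by rw [← Fintype.card_congr σ, Fintype.card_fin]
  set Z := partitionFunction G p q with hZ
  have hZ0 : 0 < Z := partitionFunction_pos G hp0 hp1 hq
  set S : Fin m → State G := fun k => initialSegment G σ k with hS
  set R : G.edgeSet → ℝ := fun e => ∑ C, pinnedWeight G p q e C
    * (if e ∈ C then 1 - p else p) * (f (flip e C) - f C) ^ 2 with hR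
  have hstep : ∀ k : Fin m, ∑ A, ∑ B, weight G p q A * weight G p q B
      * (f (splice (insert (σ k) (S k)) B A) - f (splice (S k) B A)) ^ 2
      ≤ (q : ℝ) ^ w * Z * R (σ k) := by
    intro k
    refine sum_sum_weight_mul_sub_sq_le G hp0 hp1 hq w (by simp [hS, mem_initialSegment]) ?_ f
    intro C D
    obtain ⟨W, hWne, hWw, hW⟩ := hσ k
    have := numComponents_exchange G (S k : Set G.edgeSet) W hWne
      (by
        intro e he e' he' v
        exact hW e e' (mem_initialSegment G |>.mp he)
          (not_lt.mp fun h => he' (mem_initialSegment G |>.mpr h)) v)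
      (D ∩ S k) (C \ S k) (C ∩ S k) (D \ S k) (by simp) (by simp) (by simp) (by simp)
    have h1 : (C ∩ S k) ∪ (C \ S k) = C := by
      rw [Finset.union_comm]; exact Finset.sdiff_union_inter C (S k)
    have h2 : (D ∩ S k) ∪ (D \ S k) = D := by
      rw [Finset.union_comm]; exact Finset.sdiff_union_inter D (S k)
    rw [h1, h2] at this
    exact this.trans (by omega)
  -- Cauchy–Schwarz over a path of `m` steps gives one factor `m`; the other factor in `m ^ 2` is
  -- the `1 / m` chance of choosing an edge.
  have hCS : ∀ A B : State G, (f B - f A) ^ 2 ≤ m * ∑ k : Fin m,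
      (f (splice (insert (σ k) (S k)) B A) - f (splice (S k) B A)) ^ 2 := by
    intro A B
    rw [sub_eq_sum_splice_initialSegment G σ f A B]
    refine (sq_sum_le_card_mul_sum_sq).trans_eq ?_
    rw [Finset.card_univ, Fintype.card_fin]
  have hvar : 2 * weightedVariance (rcMeasure G p q) f
      ≤ m * ((q : ℝ) ^ w * Z * ∑ e, R e) / Z ^ 2 := by
    rw [← sum_sum_mul_sub_sq _ _ (sum_rcMeasure G hp0 hp1 hq), le_div_iff₀ (by positivity)]
    calc (∑ A, ∑ B, rcMeasure G p q A * rcMeasure G p q B * (f B - f A) ^ 2) * Z ^ 2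
        = ∑ A, ∑ B, weight G p q A * weight G p q B * (f B - f A) ^ 2 := by
          simp_rw [Finset.sum_mul]
          refine Finset.sum_congr rfl fun A _ => Finset.sum_congr rfl fun B _ => ?_
          rw [rcMeasure, rcMeasure, ← hZ]
          field_simp
      _ ≤ ∑ A, ∑ B, weight G p q A * weight G p q B * (m * ∑ k : Fin m,
          (f (splice (insert (σ k) (S k)) B A) - f (splice (S k) B A)) ^ 2) :=
          Finset.sum_le_sum fun A _ => Finset.sum_le_sum fun B _ =>
            mul_le_mul_of_nonneg_left (hCS A B)
              (mul_pos (weight_pos G hp0 hp1 hq A) (weight_pos G hp0 hp1 hq B)).le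
      _ = m * ∑ k : Fin m, ∑ A, ∑ B, weight G p q A * weight G p q B
          * (f (splice (insert (σ k) (S k)) B A) - f (splice (S k) B A)) ^ 2 := by
          simp_rw [Finset.mul_sum]
          rw [Finset.sum_comm' (t' := Finset.univ) (s' := fun _ => Finset.univ) (by simp)]
          rw [Finset.sum_comm]
          rw [Finset.sum_comm (s := (Finset.univ : Finset (Fin m)))]
          refine Finset.sum_congr rfl fun A _ => ?_
          rw [Finset.sum_comm (s := (Finset.univ : Finset (Fin m)))]
          refine Finset.sum_congr rfl fun B _ => Finset.sum_congr rfl fun k _ => ?_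
          ring
      _ ≤ m * ∑ k : Fin m, (q : ℝ) ^ w * Z * R (σ k) := by
          gcongr with k
          exact hstep k
      _ = _ := by rw [← Finset.mul_sum, σ.sum_comp]
  rw [dirichletForm_singleBond G hp1 hq f, hm, ← hZ]
  -- Without edges `1 / (4 * m)` is `0` by convention, and `hvar` already makes the variance
  -- nonpositive.
  rcases Nat.eq_zero_or_pos m with h0 | h0
  · have hm0 : (m : ℝ) = 0 := by exact_mod_cast h0
    rw [hm0] at hvar ⊢
    simp only [zero_mul, zero_div] at hvar
    simp only [ne_eq, OfNat.ofNat_ne_zero, not_false_eq_true, zero_pow, mul_zero, zero_mul]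
    linarith
  · have hm0 : (0 : ℝ) < m := by exact_mod_cast h0
    have : m * ((q : ℝ) ^ w * Z * ∑ e, R e) / Z ^ 2
      = 2 * (2 * (m : ℝ) ^ 2 * (q : ℝ) ^ w * (1 / (4 * (m : ℝ)) / Z * ∑ e, R e)) := by
      field_simp
      ring
    linarith

end Dynamics

end RandomCluster

namespace RandomCluster

/-! ### Ergodicity of the single-bond chain and the smallest stationary weight. -/

section SingleBond

variable {V : Type*} (G : SimpleGraph V) [DecidableEq V] [Fintype V] [DecidableRel G.Adj]
  {p : ℝ} {q : ℕ}

theorem singleBond_nonneg (hp0 : 0 < p) (hp1 : p < 1) (hq : 1 ≤ q) (A B : State G) :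
    0 ≤ singleBond G p q A B := by
  have h1 : 0 ≤ ∑ e, edgeUpdate G p q e A B :=
    Finset.sum_nonneg fun e _ => edgeUpdate_nonneg G hp0 hp1 hq e A B
  rw [singleBond, Matrix.of_apply]
  refine add_nonneg ?_ (mul_nonneg (by positivity) h1)
  split_ifs <;> norm_num

theorem half_le_singleBond (hp0 : 0 < p) (hp1 : p < 1) (hq : 1 ≤ q) (A : State G) :
    1 / 2 ≤ singleBond G p q A A := by
  have h1 : 0 ≤ ∑ e, edgeUpdate G p q e A A :=
    Finset.sum_nonneg fun e _ => edgeUpdate_nonneg G hp0 hp1 hq e A A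
  rw [singleBond, Matrix.of_apply, if_pos rfl]
  exact le_add_of_nonneg_right (mul_nonneg (by positivity) h1)

theorem sum_singleBond (hE : 0 < Fintype.card G.edgeSet) (A : State G) :
    ∑ B, singleBond G p q A B = 1 := by
  have hE' : (Fintype.card G.edgeSet : ℝ) ≠ 0 := by exact_mod_cast hE.ne'
  simp only [singleBond, Matrix.of_apply, Finset.sum_add_distrib, ← Finset.sum_div,
    ← Finset.mul_sum]
  rw [Finset.sum_comm, Finset.sum_congr rfl fun e _ => sum_edgeUpdate G e A]
  simp only [Finset.sum_ite_eq, Finset.mem_univ, if_true, Finset.sum_const, Finset.card_univ,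
    nsmul_eq_mul, mul_one]
  field_simp
  norm_num

theorem rcMeasure_mul_singleBond_comm (hp1 : p < 1) (hq : 1 ≤ q) (A B : State G) :
    rcMeasure G p q A * singleBond G p q A B = rcMeasure G p q B * singleBond G p q B A := by
  rcases eq_or_ne A B with rfl | hAB
  · rfl
  have h : weight G p q A * ∑ e, edgeUpdate G p q e A B
      = weight G p q B * ∑ e, edgeUpdate G p q e B A := by
    rw [Finset.mul_sum, Finset.mul_sum]
    exact Finset.sum_congr rfl fun e _ => weight_mul_edgeUpdate_comm G hp1 hq e A B
  rw [singleBond, Matrix.of_apply, Matrix.of_apply, if_neg hAB, if_neg hAB.symm, rcMeasure,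
    rcMeasure]
  linear_combination
    1 / (2 * (Fintype.card G.edgeSet : ℝ)) / partitionFunction G p q * h

theorem singleBond_flip_pos (hp0 : 0 < p) (hp1 : p < 1) (hq : 1 ≤ q) (e : G.edgeSet)
    (A : State G) : 0 < singleBond G p q A (flip e A) := by
  have hE : (0 : ℝ) < Fintype.card G.edgeSet := by exact_mod_cast Fintype.card_pos_iff.mpr ⟨e⟩
  have h1 : 0 < ∑ e', edgeUpdate G p q e' A (flip e A) :=
    Finset.sum_pos' (fun e' _ => edgeUpdate_nonneg G hp0 hp1 hq e' A _)
      ⟨e, Finset.mem_univ e, edgeUpdate_flip_pos G hp0 hp1 hq e A⟩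
  rw [singleBond, Matrix.of_apply]
  refine add_pos_of_nonneg_of_pos ?_ (mul_pos (by positivity) h1)
  split_ifs <;> norm_num

/-- Flip the edges of the symmetric difference one after another. -/
theorem singleBond_irreducible (hp0 : 0 < p) (hp1 : p < 1) (hq : 1 ≤ q) (A B : State G) :
    ∃ t : ℕ, 0 < (singleBond G p q ^ t) A B := by
  have key : ∀ S : State G, ∃ t : ℕ, 0 < (singleBond G p q ^ t) A (symmDiff A S) := by
    intro S
    induction S using Finset.induction_on with
    | empty =>
      refine ⟨0, ?_⟩
      rw [← Finset.bot_eq_empty, symmDiff_bot, pow_zero, Matrix.one_apply_eq]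
      exact one_pos
    | insert e S he ih =>
      refine exists_pow_pos_trans _ (singleBond_nonneg G hp0 hp1 hq) ih ?_
      convert singleBond_flip_pos G hp0 hp1 hq e (symmDiff A S) using 2
      ext x
      unfold flip
      rcases eq_or_ne x e with rfl | hx
      · by_cases h : x ∈ A <;> simp [Finset.mem_symmDiff, he, h]
      · split_ifs <;> simp [Finset.mem_symmDiff, hx]
  have := key (symmDiff A B)
  rwa [symmDiff_symmDiff_cancel_left] at this

theorem isErgodicChain_singleBond (hE : 0 < Fintype.card G.edgeSet) (hp0 : 0 < p) (hp1 : p < 1)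
    (hq : 1 ≤ q) (C : ℝ)
    (hgap : ∀ f, weightedVariance (rcMeasure G p q) f
      ≤ C * dirichletForm (singleBond G p q) (rcMeasure G p q) f) :
    IsErgodicChain (singleBond G p q) (rcMeasure G p q) where
  nonneg := singleBond_nonneg G hp0 hp1 hq
  row_sum := sum_singleBond G hE
  irreducible := singleBond_irreducible G hp0 hp1 hq
  aperiodic A g hg := by
    refine Nat.dvd_one.mp (hg 1 ?_)
    rw [pow_one]
    linarith [half_le_singleBond G hp0 hp1 hq A]
  stationary := ⟨⟨fun A => (rcMeasure_pos G hp0 hp1 hq A).le, sum_rcMeasure G hp0 hp1 hq⟩,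
    vecMul_eq_of_reversible _ _ (rcMeasure_mul_singleBond_comm G hp1 hq) (sum_singleBond G hE)⟩
  unique := eq_of_isStationaryDistribution _ _ (rcMeasure_pos G hp0 hp1 hq)
    (sum_rcMeasure G hp0 hp1 hq) (rcMeasure_mul_singleBond_comm G hp1 hq)
    (singleBond_nonneg G hp0 hp1 hq) (sum_singleBond G hE) (half_le_singleBond G hp0 hp1 hq) C hgap

/-- Every weight is at least `p ^ |E|`, since `p / (1 - p) ≥ p` and `q ≥ 1`. Bounding `q ^ c` by `q
^ |V|` in `Z` leaves a binomial sum equal to `(1 - p) ^ (-|E|)`. -/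
theorem log_one_div_rcMeasure_le (hp0 : 0 < p) (hp1 : p < 1) (hq : 1 ≤ q) (A : State G) :
    Real.log (1 / rcMeasure G p q A)
      ≤ Fintype.card G.edgeSet * Real.log (1 / (p * (1 - p)))
        + Fintype.card V * Real.log q := by
  have hp : 0 < 1 - p := by linarith
  have hq' : (1 : ℝ) ≤ q := by exact_mod_cast hq
  have hq0 : (0 : ℝ) < q := by linarith
  set m := Fintype.card G.edgeSet with hm
  have hw : p ^ m ≤ weight G p q A := by
    have h1 : p ≤ p / (1 - p) := by
      rw [le_div_iff₀ hp]; nlinarith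
    have h2 : A.card ≤ m := A.card_le_univ
    calc p ^ m ≤ p ^ A.card := pow_le_pow_of_le_one hp0.le hp1.le h2
      _ ≤ (p / (1 - p)) ^ A.card := by gcongr
      _ ≤ weight G p q A := le_mul_of_one_le_right (by positivity) (one_le_pow₀ hq')
  have hZ : partitionFunction G p q ≤ (1 / (1 - p)) ^ m * (q : ℝ) ^ Fintype.card V := by
    have h1 : (1 / (1 - p)) ^ m = ∑ B : State G, (p / (1 - p)) ^ B.card := by
      have := Fintype.sum_pow_mul_eq_add_pow G.edgeSet (p / (1 - p)) 1
      simp only [one_pow, mul_one] at this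
      rw [this]
      congr 1
      field_simp
      ring
    rw [h1, Finset.sum_mul, partitionFunction]
    refine Finset.sum_le_sum fun B _ => ?_
    have := numComponents_le_card G B
    unfold weight
    gcongr
  have hμ : 1 / rcMeasure G p q A ≤ (1 / (p * (1 - p))) ^ m * (q : ℝ) ^ Fintype.card V := by
    rw [rcMeasure, one_div_div, div_le_iff₀ (weight_pos G hp0 hp1 hq A)]
    calc partitionFunction G p q ≤ (1 / (1 - p)) ^ m * (q : ℝ) ^ Fintype.card V := hZ
      _ = (1 / (p * (1 - p))) ^ m * (q : ℝ) ^ Fintype.card V * p ^ m := by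
          rw [one_div_pow, one_div_pow, mul_pow]
          field_simp
      _ ≤ _ := by gcongr
  calc _ ≤ Real.log ((1 / (p * (1 - p))) ^ m * (q : ℝ) ^ Fintype.card V) :=
        Real.log_le_log (one_div_pos.mpr (rcMeasure_pos G hp0 hp1 hq A)) hμ
    _ = _ := by
        rw [Real.log_mul (by positivity) (by positivity), Real.log_pow, Real.log_pow]

end SingleBond

end RandomCluster

/-! ### An edge order of the torus with small interfaces. -/

section Torus

theorem torusGraph_adj_val_zero {L n : ℕ} [NeZero L] (hL : 2 ≤ L) {x y : Fin (n + 1) → ZMod L}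
    (h : (torusGraph L (n + 1)).Adj x y) :
    (x 0).val = (y 0).val ∨ (y 0).val = (x 0).val + 1 ∨ (x 0).val = (y 0).val + 1 ∨
      ((x 0).val = L - 1 ∧ (y 0).val = 0) ∨ ((y 0).val = L - 1 ∧ (x 0).val = 0) := by
  have step : ∀ x y : Fin (n + 1) → ZMod L, (∃ i, y = x + Pi.single i 1) →
      (x 0).val = (y 0).val ∨ (y 0).val = (x 0).val + 1 ∨
        ((x 0).val = L - 1 ∧ (y 0).val = 0) := by
    rintro x y ⟨i, rfl⟩
    rcases eq_or_ne i 0 with rfl | hi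
    · have h1 : ((x + Pi.single 0 1 : Fin (n + 1) → ZMod L) 0).val = ((x 0).val + 1) % L := by
        rw [Pi.add_apply, Pi.single_eq_same, ZMod.val_add, ZMod.val_one'' (by omega)]
      have h2 := ZMod.val_lt (x 0)
      rw [h1]
      rcases Nat.lt_or_ge ((x 0).val + 1) L with h3 | h3
      · rw [Nat.mod_eq_of_lt h3]; omega
      · have h4 : (x 0).val + 1 = L := by omega
        rw [h4, Nat.mod_self]; omega
    · left
      rw [Pi.add_apply, Pi.single_eq_of_ne hi.symm, add_zero]
  rw [torusGraph, SimpleGraph.fromRel_adj] at h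
  rcases h.2 with h | h
  · have := step x y h; omega
  · have := step y x h; omega

/-- The smaller of the first coordinates of the two endpoints. -/
def edgeLevel {L n : ℕ} : Sym2 (Fin (n + 1) → ZMod L) → ℕ :=
  Sym2.lift ⟨fun x y => min (x 0).val (y 0).val, fun _ _ => min_comm _ _⟩

theorem card_filter_val_zero_le {L n : ℕ} [NeZero L] (c : ℕ) :
    (Finset.univ.filter fun v : Fin (n + 1) → ZMod L => (v 0).val = c).card ≤ L ^ n := by
  have h : Fintype.card (Fin n → ZMod L) = L ^ n := by simp [ZMod.card]
  rw [← h, ← Finset.card_univ]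
  refine Finset.card_le_card_of_injOn Fin.tail (fun _ _ => Finset.mem_coe.mpr (Finset.mem_univ _)) ?_
  intro v hv u hu hvu
  have h0 : v 0 = u 0 := ZMod.val_injective L
    ((Finset.mem_filter.mp hv).2.trans (Finset.mem_filter.mp hu).2.symm)
  rw [← Fin.cons_self_tail v, ← Fin.cons_self_tail u, h0, hvu]

theorem exists_torusGraph_separator {L n : ℕ} [NeZero L] (hL : 2 ≤ L) (j : ℕ) :
    ∃ W : Finset (Fin (n + 1) → ZMod L), W.Nonempty ∧ W.card ≤ 3 * L ^ n ∧
      ∀ e e' : (torusGraph L (n + 1)).edgeSet, edgeLevel e.1 ≤ j → j ≤ edgeLevel e'.1 →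
        ∀ v, v ∈ (e : Sym2 (Fin (n + 1) → ZMod L)) → v ∈ (e' : Sym2 (Fin (n + 1) → ZMod L)) →
          v ∈ W := by
  let layer : ℕ → Finset (Fin (n + 1) → ZMod L) := fun c => Finset.univ.filter fun v =>
    (v 0).val = c
  -- An ordinary edge of level at most `j` reaches no higher than layer `j + 1`. A wrap-around edge
  -- has level `0` but an end in layer `L - 1`, hence the third layer.
  refine ⟨layer j ∪ layer (j + 1) ∪ layer (L - 1), ⟨fun _ => ((L - 1 : ℕ) : ZMod L), ?_⟩, ?_, ?_⟩
  · refine Finset.mem_union_right _ (Finset.mem_filter.mpr ⟨Finset.mem_univ _, ?_⟩)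
    rw [ZMod.val_natCast, Nat.mod_eq_of_lt (by omega)]
  · have h1 := Finset.card_union_le (layer j ∪ layer (j + 1)) (layer (L - 1))
    have h2 := Finset.card_union_le (layer j) (layer (j + 1))
    have h3 : ∀ c, (layer c).card ≤ L ^ n := card_filter_val_zero_le
    have := h3 j
    have := h3 (j + 1)
    have := h3 (L - 1)
    omega
  · rintro ⟨e, he⟩ ⟨e', he'⟩ h1 h2 v hv hv'
    obtain ⟨y, rfl⟩ := hv
    obtain ⟨y', rfl⟩ := hv'
    have h3 := torusGraph_adj_val_zero (x := v) (y := y) hL he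
    have h1' : min (v 0).val (y 0).val ≤ j := h1
    have h2' : j ≤ min (v 0).val (y' 0).val := h2
    simp only [layer, Finset.mem_union, Finset.mem_filter, Finset.mem_univ, true_and]
    omega

theorem exists_torusGraph_edge_order {L n : ℕ} [NeZero L] (hL : 2 ≤ L) :
    ∃ σ : Fin (Fintype.card (torusGraph L (n + 1)).edgeSet) ≃ (torusGraph L (n + 1)).edgeSet,
      ∀ k, ∃ W : Finset (Fin (n + 1) → ZMod L), W.Nonempty ∧ W.card ≤ 3 * L ^ n ∧
        ∀ e e' : (torusGraph L (n + 1)).edgeSet, σ.symm e < k → k ≤ σ.symm e' →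
          ∀ v, v ∈ (e : Sym2 (Fin (n + 1) → ZMod L)) → v ∈ (e' : Sym2 (Fin (n + 1) → ZMod L)) →
            v ∈ W := by
  let τ := (Fintype.equivFin (torusGraph L (n + 1)).edgeSet).symm
  let g : Fin (Fintype.card (torusGraph L (n + 1)).edgeSet) → ℕ := fun i => edgeLevel (τ i).1
  -- Ties may fall on either side of the cut; the separator admits edges of level exactly `j` on
  -- both sides.
  have hmono : Monotone fun i => edgeLevel (((Tuple.sort g).trans τ) i).1 := Tuple.monotone_sort g
  refine ⟨(Tuple.sort g).trans τ, fun k => ?_⟩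
  set σ := (Tuple.sort g).trans τ
  obtain ⟨W, h1, h2, h3⟩ := exists_torusGraph_separator (n := n) hL (edgeLevel (σ k).1)
  refine ⟨W, h1, h2, fun e e' he he' => h3 e e' ?_ ?_⟩
  · simpa using hmono he.le
  · simpa using hmono he'

theorem card_torusGraph_edgeSet_le {L d : ℕ} [NeZero L] :
    Fintype.card (torusGraph L d).edgeSet ≤ d * L ^ d := by
  have h : (torusGraph L d).edgeFinset ⊆ Finset.univ.image
      fun x : (Fin d → ZMod L) × Fin d => s(x.1, x.1 + Pi.single x.2 1) := by
    intro e he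
    induction e using Sym2.ind with
    | _ x y =>
      rw [SimpleGraph.mem_edgeFinset, SimpleGraph.mem_edgeSet, torusGraph,
        SimpleGraph.fromRel_adj] at he
      rw [Finset.mem_image]
      rcases he.2 with ⟨i, rfl⟩ | ⟨i, rfl⟩
      · exact ⟨(x, i), Finset.mem_univ _, rfl⟩
      · exact ⟨(y, i), Finset.mem_univ _, Sym2.eq_swap⟩
  rw [← SimpleGraph.edgeFinset_card]
  refine (Finset.card_le_card h).trans (Finset.card_image_le.trans_eq ?_)
  rw [Finset.card_univ, Fintype.card_prod, Fintype.card_fin, mul_comm]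
  simp [ZMod.card]

theorem card_torusGraph_edgeSet_pos {L n : ℕ} [NeZero L] (hL : 2 ≤ L) :
    0 < Fintype.card (torusGraph L (n + 1)).edgeSet := by
  rw [Fintype.card_pos_iff]
  refine ⟨⟨s(0, Pi.single 0 1), ?_⟩⟩
  have : Fact (1 < L) := ⟨hL⟩
  rw [SimpleGraph.mem_edgeSet, torusGraph, SimpleGraph.fromRel_adj]
  exact ⟨fun h => by simpa using congrFun h 0, Or.inl ⟨0, by simp⟩⟩

end Torus

/-! ### Numerical estimates behind `k₁` and `k₂`. -/

section Estimates

theorem two_mul_pow_nine_le_exp {x : ℝ} (hx : 2 ≤ x) : 2 * x ^ 9 ≤ Real.exp (4 * x) := by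
  have hx0 : 0 < x := by linarith
  have he := Real.exp_one_gt_d9
  have h1 : Real.log x ≤ x / Real.exp 1 := by
    have := Real.log_le_sub_one_of_pos (div_pos hx0 (Real.exp_pos 1))
    rw [Real.log_div hx0.ne' (Real.exp_pos 1).ne', Real.log_exp] at this
    linarith
  -- From `e > 2.7`, `9 log x ≤ (10 / 3) x`; the remaining `(2 / 3) x ≥ 4 / 3` exceeds `log 2`.
  have h2 : x / Real.exp 1 ≤ x * (10 / 27) := by
    rw [div_le_iff₀ (Real.exp_pos 1)]
    nlinarith
  have h3 := Real.log_two_lt_d9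
  rw [← Real.log_le_iff_le_exp (by positivity), Real.log_mul (by norm_num) (by positivity),
    Real.log_pow]
  norm_num
  linarith

theorem dim_mul_pow_le {L n : ℕ} (hL : 2 ≤ L) (hn : 1 ≤ n) :
    (n + 1) * L ^ (n + 1) ≤ (L ^ n) ^ 3 := by
  have h1 : n + 1 ≤ L ^ n := (Nat.lt_two_pow_self).trans_le (Nat.pow_le_pow_left hL n)
  have h2 : L ≤ L ^ n := Nat.le_self_pow (by omega) L
  calc (n + 1) * L ^ (n + 1) = (n + 1) * (L * L ^ n) := by rw [pow_succ']
    _ ≤ L ^ n * (L ^ n * L ^ n) := Nat.mul_le_mul h1 (Nat.mul_le_mul_right _ h2)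
    _ = (L ^ n) ^ 3 := by ring

theorem eight_le_dim_mul_pow {L n : ℕ} (hL : 2 ≤ L) (hn : 1 ≤ n) :
    8 ≤ (n + 1) * L ^ (n + 1) := by
  have h1 : 2 ^ 2 ≤ L ^ (n + 1) :=
    (Nat.pow_le_pow_left hL 2).trans (Nat.pow_le_pow_right (by omega) (by omega))
  nlinarith

theorem exp_k₁_add_k₂_mul {p : ℝ} {q : ℕ} (hl : 0 ≤ Real.log (1 / (p * (1 - p)))) (hq : 1 ≤ q)
    (N : ℕ) :
    Real.exp (k₁ p + k₂ q * N) = (1 + Real.log (1 / (p * (1 - p))))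
      * (Real.exp (4 * N) * (q : ℝ) ^ (3 * N) * (1 + Real.log q) ^ N) := by
  have hq0 : (0 : ℝ) < q := by exact_mod_cast hq
  have hlq : 0 ≤ Real.log q := Real.log_natCast_nonneg q
  have h : k₁ p + k₂ q * N = Real.log (1 + Real.log (1 / (p * (1 - p))))
      + (4 * N + (((3 * N : ℕ) : ℝ) * Real.log q) + N * Real.log (1 + Real.log q)) := by
    unfold k₁ k₂
    push_cast
    ring
  rw [h, Real.exp_add, Real.exp_log (by linarith), Real.exp_add, Real.exp_add, Real.exp_nat_mul,
    Real.exp_nat_mul, Real.exp_log hq0, Real.exp_log (by linarith)]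

/-- Here `M` bounds both `|E|` and `|V|`, `Q` is the congestion factor `q ^ (3N)`, and the added `1`
pays for rounding the time up. The polynomial factor is absorbed in `X`, and the logarithms of `p`
and `q` are separated by `1 + l + lq ≤ (1 + l)(1 + lq)`. -/
theorem mixing_estimate {m v M l lq Q X Y : ℝ} (hm0 : 0 ≤ m) (hmM : m ≤ M)
    (hv0 : 0 ≤ v) (hvM : v ≤ M) (hM : 8 ≤ M) (hl : 0 ≤ l) (hlq : 0 ≤ lq) (hQ : 1 ≤ Q) (hX : 2 * M ^ 3 ≤ X)
    (hY : 1 + lq ≤ Y) :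
    2 * m ^ 2 * Q * (2 + (m * l + v * lq)) + 1 ≤ (1 + l) * (X * Q * Y) := by
  have hX0 : 0 ≤ X := le_trans (by positivity) hX
  have h3 : 4 * M ^ 2 + 1 ≤ 2 * M ^ 3 := by nlinarith [sq_nonneg M]
  have h4 : 0 ≤ 2 * M ^ 3 := by positivity
  have hM0 : 0 ≤ M := by linarith
  calc 2 * m ^ 2 * Q * (2 + (m * l + v * lq)) + 1
      ≤ 2 * M ^ 2 * Q * (2 + (M * l + M * lq)) + 1 * Q := by
        gcongr
        linarith
    _ = Q * (4 * M ^ 2 + 1 + 2 * M ^ 3 * l + 2 * M ^ 3 * lq) := by ring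
    _ ≤ Q * (2 * M ^ 3 * ((1 + l) * (1 + lq))) := by
        refine mul_le_mul_of_nonneg_left ?_ (by linarith)
        have : 0 ≤ 2 * M ^ 3 * (l * lq) := by positivity
        nlinarith
    _ = (1 + l) * (2 * M ^ 3 * Q * (1 + lq)) := by ring
    _ ≤ (1 + l) * (X * Q * Y) := by gcongr

end Estimates

theorem mainTheorem5 (L d : ℕ) [NeZero L] (hL : 2 ≤ L) (hd : 2 ≤ d)
    (p : ℝ) (hp0 : 0 < p) (hp1 : p < 1) (q : ℕ) (hq : 1 ≤ q) :
    IsErgodicChain (RandomCluster.singleBond (torusGraph L d) p q)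
        (RandomCluster.rcMeasure (torusGraph L d) p q) ∧
      ∃ τ : ℕ,
        IsMixingTime (RandomCluster.singleBond (torusGraph L d) p q)
          (RandomCluster.rcMeasure (torusGraph L d) p q) τ ∧
        (τ : ℝ) ≤ Real.exp (k₁ p + k₂ q * (L : ℝ) ^ (d - 1)) := by
  obtain ⟨n, rfl⟩ : ∃ n, d = n + 1 := ⟨d - 1, by omega⟩
  have hn : 1 ≤ n := by omega
  set G := torusGraph L (n + 1)
  set m := Fintype.card G.edgeSet with hm
  have hmpos : 0 < m := card_torusGraph_edgeSet_pos hL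
  have hq' : (1 : ℝ) ≤ q := by exact_mod_cast hq
  obtain ⟨σ, hσ⟩ := exists_torusGraph_edge_order (n := n) hL
  set C : ℝ := 2 * (m : ℝ) ^ 2 * (q : ℝ) ^ (3 * L ^ n) with hC
  have hgap : ∀ f, weightedVariance (RandomCluster.rcMeasure G p q) f
      ≤ C * dirichletForm (RandomCluster.singleBond G p q) (RandomCluster.rcMeasure G p q) f :=
    RandomCluster.weightedVariance_le_dirichletForm G hp0 hp1 hq (3 * L ^ n) σ hσ
  have hC1 : 1 ≤ C := by
    have h1 : (1 : ℝ) ≤ m := by exact_mod_cast hmpos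
    have h2 : (1 : ℝ) ≤ (m : ℝ) ^ 2 := one_le_pow₀ h1
    have h3 : (1 : ℝ) ≤ (q : ℝ) ^ (3 * L ^ n) := one_le_pow₀ hq'
    nlinarith
  refine ⟨RandomCluster.isErgodicChain_singleBond G hmpos hp0 hp1 hq C hgap, ?_⟩
  set l := Real.log (1 / (p * (1 - p))) with hl
  have hpp : 0 < p * (1 - p) := mul_pos hp0 (by linarith)
  have hl0 : 0 ≤ l := Real.log_nonneg (by rw [le_div_iff₀ hpp]; nlinarith)
  have hlq : 0 ≤ Real.log q := Real.log_natCast_nonneg q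
  set K : ℝ := m * l + Fintype.card (Fin (n + 1) → ZMod L) * Real.log q with hK
  have hmem : ⌈C * (2 + K)⌉₊ ∈ {t : ℕ | ∀ x, ∑ y, |(RandomCluster.singleBond G p q ^ t) x y
      - RandomCluster.rcMeasure G p q y| ≤ 1 / Real.exp 1} := fun A =>
    sum_abs_pow_sub_le_of_le _ _ (RandomCluster.rcMeasure_pos G hp0 hp1 hq)
      (RandomCluster.sum_rcMeasure G hp0 hp1 hq)
      (RandomCluster.rcMeasure_mul_singleBond_comm G hp1 hq)
      (RandomCluster.singleBond_nonneg G hp0 hp1 hq) (RandomCluster.sum_singleBond G hmpos)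
      (RandomCluster.half_le_singleBond G hp0 hp1 hq) C hC1 hgap K _ (Nat.le_ceil _) A
      (RandomCluster.log_one_div_rcMeasure_le G hp0 hp1 hq A)
  -- The mixing time is the infimum of the admissible times, attained because `hmem` exhibits one.
  refine ⟨_, ⟨Nat.sInf_mem ⟨_, hmem⟩, fun _ => Nat.sInf_le⟩, ?_⟩
  refine (Nat.cast_le.mpr (Nat.sInf_le hmem)).trans ?_
  have hK0 : 0 ≤ K := by positivity
  refine (Nat.ceil_lt_add_one (by positivity)).le.trans ?_
  rw [Nat.add_sub_cancel, ← Nat.cast_pow, exp_k₁_add_k₂_mul hl0 hq, hK, hC]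
  have hN : 2 ≤ L ^ n := hL.trans (Nat.le_self_pow (by omega) L)
  refine mixing_estimate (M := (((n + 1) * L ^ (n + 1) : ℕ) : ℝ)) (Nat.cast_nonneg _) ?_
    (Nat.cast_nonneg _) ?_ ?_ hl0 hlq (one_le_pow₀ hq') ?_ ?_
  · exact_mod_cast card_torusGraph_edgeSet_le
  · have : Fintype.card (Fin (n + 1) → ZMod L) = L ^ (n + 1) := by simp [ZMod.card]
    rw [this]
    exact_mod_cast Nat.le_mul_of_pos_left _ (by omega)
  · exact_mod_cast eight_le_dim_mul_pow hL hn
  -- With `N = L ^ n`, `M ≤ N ^ 3` gives `2 M ^ 3 ≤ 2 N ^ 9 ≤ exp (4 N)`, the source of the `4` in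
  -- `k₂`.
  · refine le_trans ?_ (two_mul_pow_nine_le_exp (x := ((L ^ n : ℕ) : ℝ)) (by exact_mod_cast hN))
    have : ((L ^ n : ℕ) : ℝ) ^ 9 = (((L ^ n) ^ 3 : ℕ) : ℝ) ^ 3 := by push_cast; ring
    rw [this]
    have := dim_mul_pow_le hL hn
    gcongr
  · exact le_self_pow₀ (by linarith) (by omega)
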